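/- **Definitions.** Let $1\le p<\infty$ and let $G$ be a group. An *$L_p$ lattice* is a Banach lattice $E$ of the form $L^p(X,\mathcal F,\mu)$ (real-valued functions, up to isometric linear lattice isomorphism) for some measure space $(X,\mathcal F,\mu)$, with the usual norm and almost everywhere order. A *$G$-$L_p$ lattice* $(E,\rho)$ is an $L_p$ lattice $E$ with a homomorphism $\rho$ from $G$ to the group of isometric linear lattice automorphisms of $E$. An *isomorphism* $(E,\rho)\to(E',\rho')$ is an isometric linear lattice isomorphism $\Phi:E\to E'$ with $\Phi\circ\rho(g)=\rho'(g)\circ\Phi$ for all $g\in G$. A *non-singular action* of $G$ on a measure space $(Z,\Sigma,\mu)$ is a homomorphism $\pi$ from $G$ to the group of bijections $\varphi:Z\to Z$ such that $\varphi,\varphi^{-1}$ are measurable and $\mu(\varphi^{-1}A)=0\iff\mu(A)=0$ for all $A\in\Sigma$. The measure $\mu$ is *semi-finite* if every $A\in\Sigma$ with $\mu(A)=\infty$ has a subset $B\in\Sigma$ with $0<\mu(B)<\infty$. For semi-finite $\mu$, write $L^p(Z,\Sigma,\mu,\pi)$ for the $G$-$L_p$ lattice $L^p(Z,\Sigma,\mu)$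 on which $g\in G$ acts by $$f\longmapsto \Big(\frac{d(\pi(g)_*\mu)}{d\mu}\Big)^{1/p}\cdot\big(f\circ\pi(g)^{-1}\big),$$ where the derivative is a measurable $D_g:Z\to[0,\infty)$ with $\mu(\pi(g)^{-1}A)=\int_A D_g\,d\mu$ for all $A\in\Sigma$ (its existence, for every $g$, is part of the assertion below; it is unique up to null sets). Two elements $x,y\in E$ are *disjoint* if $|x|\wedge|y|=0$. A *weak unit* is an element $u\in E$ such that no non-zero $w\in E$ is disjoint from $u$. **Theorem 3.14 (representation of $G$-$L_p$ lattices).** Let $(E,\rho)$ be a $G$-$L_p$ lattice. 1. Let $E_0$ be a maximal set of non-zero, pairwise disjoint positive elements of $E$. Then there are a semi-finite measure space $(Z,\Sigma,\mu)$, a non-singular action $\pi$ of $G$ on it, and an isomorphism of $G$-$L_p$ lattices $\Phi:(E,\rho)\to L^p(Z,\Sigma,\mu,\pi)$ such that for every $e\in E_0$ one has $\Phi(e)=\chi_A$ for some $A\in\Sigma$ of finite measure. 2. If $u\ge 0$ is a weak unit of $E$, then there are $(Z,\Sigma,\mu)$, $\pi$ and $\Phi:(E,\rho)\to L^p(Z,\Sigma,\mu,\pi)$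 as in 1 (with the condition on $E_0$ omitted) such that $\mu(Z)=\|u\|^p$ and $\Phi(u)=\chi_Z$. -/

import Mathlib

open MeasureTheory

open scoped ENNReal NNReal

universe u v w

/-- A linear isometric equivalence that preserves the lattice operations, i.e. an isomorphism of
Banach lattices. -/
def IsLatticeIso {E F : Type*} [NormedAddCommGroup E] [NormedSpace ℝ E] [Lattice E]
    [NormedAddCommGroup F] [NormedSpace ℝ F] [Lattice F] (T : E ≃ₗᵢ[ℝ] F) : Prop :=
  ∀ x y : E, T (x ⊔ y) = T x ⊔ T y ∧ T (x ⊓ y) = T x ⊓ T y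

/-- `E` is an `L_p` lattice: it is of the form `L^p(X, 𝓕, μ)` for some measure space, with its norm
and its almost everywhere order. All Banach lattice laws of `E` follow from this, since they hold
in `L^p` for `1 ≤ p`. -/
def IsLpLattice (p : ℝ≥0∞) [Fact (1 ≤ p)] (E : Type u)
    [NormedAddCommGroup E] [NormedSpace ℝ E] [Lattice E] : Prop :=
  ∃ (X : Type v) (_ : MeasurableSpace X) (μ : Measure X) (Φ : E ≃ₗᵢ[ℝ] Lp ℝ p μ), IsLatticeIso Φ

/-- The group of Banach-lattice automorphisms of `E`. -/
def LatticeAut (E : Type*) [NormedAddCommGroup E] [NormedSpace ℝ E] [Lattice E] :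
    Subgroup (E ≃ₗᵢ[ℝ] E) where
  carrier := {T | IsLatticeIso T}
  one_mem' := fun _ _ => ⟨rfl, rfl⟩
  mul_mem' := by
    intro S T hS hT x y
    simp only [LinearIsometryEquiv.coe_mul, Function.comp_apply]
    rw [(hT x y).1, (hT x y).2]
    exact hS _ _
  inv_mem' := by
    intro T hT x y
    have h : ∀ z, T (T⁻¹ z) = z := fun z => T.apply_symm_apply z
    refine ⟨T.injective ?_, T.injective ?_⟩
    · rw [(hT _ _).1, h, h, h]
    · rw [(hT _ _).2, h, h, h]

/-- Disjointness in a vector lattice: `|x| ∧ |y| = 0`. -/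
def LatDisjoint {E : Type*} [AddGroup E] [Lattice E] (x y : E) : Prop := |x| ⊓ |y| = 0

/-- A set of (non-zero) positive elements, pairwise disjoint. -/
def IsDisjointPositive {E : Type*} [AddGroup E] [Lattice E] (S : Set E) : Prop :=
  (∀ x ∈ S, 0 < x) ∧ S.Pairwise LatDisjoint

/-- `u` is a weak unit: no non-zero element is disjoint from it. -/
def IsWeakUnit {E : Type*} [AddGroup E] [Lattice E] (u : E) : Prop :=
  ∀ w : E, LatDisjoint u w → w = 0

/-- The group of non-singular transformations: the bimeasurable bijections `φ` such that `A` is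
null if and only if `φ⁻¹ A` is null, for each measurable `A`. -/
def NonsingularAut {Z : Type*} [MeasurableSpace Z] (μ : Measure Z) : Subgroup (Equiv.Perm Z) where
  carrier := {φ | Measurable φ ∧ Measurable φ.symm ∧
    ∀ A, MeasurableSet A → (μ (φ ⁻¹' A) = 0 ↔ μ A = 0)}
  one_mem' := ⟨measurable_id, measurable_id, fun _ _ => Iff.rfl⟩
  mul_mem' := by
    rintro φ ψ ⟨h1, h2, h3⟩ ⟨k1, k2, k3⟩
    refine ⟨h1.comp k1, k2.comp h2, fun A hA => ?_⟩
    exact (k3 _ (h1 hA)).trans (h3 A hA)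
  inv_mem' := by
    rintro φ ⟨h1, h2, h3⟩
    refine ⟨h2, h1, fun A hA => ?_⟩
    have h : φ ⁻¹' (φ.symm ⁻¹' A) = A := by ext x; simp
    have := h3 _ (h2 hA)
    rw [h] at this
    exact this.symm

/-- A semi-finite measure: each measurable set of infinite measure has a measurable subset of
positive finite measure. -/
def IsSemifinite {Z : Type*} [MeasurableSpace Z] (μ : Measure Z) : Prop :=
  ∀ A, MeasurableSet A → μ A = ∞ → ∃ B, MeasurableSet B ∧ B ⊆ A ∧ 0 < μ B ∧ μ B < ∞

/-- `T` is the operator on `L^p(Z, μ)` induced by the non-singular transformation `φ`: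
`T f = (d(φ_* μ)/dμ)^(1/p) · (f ∘ φ⁻¹)`. The Radon-Nikodym derivative `D` is a finite-valued
measurable function with `μ (φ⁻¹ A) = ∫_A D dμ` for every measurable `A`; when `μ` is semi-finite
it is unique up to null sets, so that `T` is determined by `φ`. -/
def IsInducedBy {Z : Type*} [MeasurableSpace Z] {μ : Measure Z} {p : ℝ≥0∞} [Fact (1 ≤ p)]
    (T : Lp ℝ p μ → Lp ℝ p μ) (φ : NonsingularAut μ) : Prop :=
  ∃ D : Z → ℝ≥0, Measurable D ∧
    (∀ A, MeasurableSet A → μ ((φ : Equiv.Perm Z) ⁻¹' A) = ∫⁻ z in A, (D z : ℝ≥0∞) ∂μ) ∧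
    ∀ f : Lp ℝ p μ,
      T f =ᵐ[μ] fun z => (D z : ℝ) ^ (1 / p.toReal) * f ((φ : Equiv.Perm Z).symm z)

/-- `(Lp ℝ p μ, τ)` is the concrete `G`-`L_p` lattice `L^p(Z, Σ, μ, π)`: each `τ g` is induced by
the non-singular transformation `π g` of the semi-finite measure space `(Z, Σ, μ)`. -/
def IsConcreteAction {G Z : Type*} [Group G] [MeasurableSpace Z] {μ : Measure Z} {p : ℝ≥0∞}
    [Fact (1 ≤ p)] (π : G →* NonsingularAut μ) (τ : G →* LatticeAut (Lp ℝ p μ)) : Prop :=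
  IsSemifinite μ ∧ ∀ g, IsInducedBy (τ g : Lp ℝ p μ ≃ₗᵢ[ℝ] Lp ℝ p μ) (π g)

/-- `Φ` is an isomorphism of `G`-`L_p` lattices from `(E, ρ)` to `(F, τ)`. -/
def IsGLatticeIso {G E F : Type*} [Group G] [NormedAddCommGroup E] [NormedSpace ℝ E] [Lattice E]
    [NormedAddCommGroup F] [NormedSpace ℝ F] [Lattice F] (ρ : G →* LatticeAut E)
    (τ : G →* LatticeAut F) (Φ : E ≃ₗᵢ[ℝ] F) : Prop :=
  IsLatticeIso Φ ∧ ∀ g x, Φ ((ρ g : E ≃ₗᵢ[ℝ] E) x) = (τ g : F ≃ₗᵢ[ℝ] F) (Φ x)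

/-! An automorphism of `L^p` determines a transformation of the underlying space only up to null
sets, and for an arbitrary group such transformations need not fit together into an action on
points. The remedy is a space built canonically from `E`. A band projection is a map `P` with `P f`
disjoint from `g - P g` for all `f` and `g`; automorphisms act on these maps by conjugation, hence
by permuting coordinates on the space `BandSpace E` of two-valued functions of `P`. There the group
law holds at every point.

To find the measure, divide by the members of a maximal disjoint system `e i`. This turns `E` into
`L^p` of a direct sum of finite measure spaces in which `e i` is the unit of a summand
(`exists_isDirectSum_latticeIso`). There each band projection is multiplication by an indicator
(`BandProj.exists_set`), so a point `y` gives a two-valued function of `P`: whether `y` lies in the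
set of `P`. Pushing the measure forward along this map loses nothing, since every measurable set is
the set of some `P` up to a null set (`exists_isBandRep`).

An automorphism `T` intertwines multiplication by indicators (`IsBandRep.map_indicator`). Hence the
permutation `φ` is non-singular, and comparison with rational multiples of `e j` gives `T f = T (e
j) · (f ∘ φ⁻¹)` on `φ (c j)`, where `c j` is the support of `e j`. Since `T` is isometric, gluing
the functions `|T (e j)| ^ p` gives the Radon-Nikodym derivative (`IsBandRep.exists_density`).

The system may be uncountable. Countability is recovered from finiteness: a finite measure charges
only countably many members of a disjoint family. -/

section Basics

/-! ### Disjointness, norms and truncation in `L^p`. -/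

variable {p : ℝ≥0∞}

theorem toReal_pos_of_fact [Fact (1 ≤ p)] (hp : p ≠ ∞) : 0 < p.toReal :=
  ENNReal.toReal_pos (zero_lt_one.trans_le (Fact.out : 1 ≤ p)).ne' hp

theorem latDisjoint_iff_ae {X : Type*} [MeasurableSpace X] {μ : Measure X} {f g : Lp ℝ p μ} :
    LatDisjoint f g ↔ ∀ᵐ x ∂μ, f x = 0 ∨ g x = 0 := by
  unfold LatDisjoint
  rw [Lp.ext_iff]
  have key : ∀ᵐ x ∂μ, (↑(|f| ⊓ |g|) : X →ₘ[μ] ℝ) x = min |f x| |g x| := by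
    filter_upwards [Lp.coeFn_inf |f| |g|, Lp.coeFn_abs f, Lp.coeFn_abs g] with x h1 h2 h3
    rw [h1, Pi.inf_apply, h2, h3]
  constructor
  · intro h
    filter_upwards [h, key, Lp.coeFn_zero ℝ p μ] with x h1 h2 h3
    rw [h2, h3, Pi.zero_apply] at h1
    rcases min_choice |f x| |g x| with h | h
    · left; rw [h] at h1; exact abs_eq_zero.1 h1
    · right; rw [h] at h1; exact abs_eq_zero.1 h1
  · intro h
    filter_upwards [h, key, Lp.coeFn_zero ℝ p μ] with x h1 h2 h3
    rw [h2, h3, Pi.zero_apply]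
    rcases h1 with h | h <;> simp [h]

theorem enorm_rpow_toReal [Fact (1 ≤ p)] (hp : p ≠ ∞) {X : Type*} [MeasurableSpace X]
    {μ : Measure X} (f : Lp ℝ p μ) : ‖f‖ₑ ^ p.toReal = ∫⁻ x, ‖f x‖ₑ ^ p.toReal ∂μ := by
  have h0 := toReal_pos_of_fact hp
  rw [Lp.enorm_def, eLpNorm_eq_lintegral_rpow_enorm_toReal
    (zero_lt_one.trans_le (Fact.out : 1 ≤ p)).ne' hp, ← ENNReal.rpow_mul,
    one_div_mul_cancel h0.ne', ENNReal.rpow_one]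

theorem lintegral_enorm_rpow_ne_top [Fact (1 ≤ p)] (hp : p ≠ ∞) {X : Type*} [MeasurableSpace X]
    {μ : Measure X} (f : Lp ℝ p μ) : ∫⁻ x, ‖f x‖ₑ ^ p.toReal ∂μ ≠ ∞ := by
  rw [← enorm_rpow_toReal hp]
  exact ENNReal.rpow_ne_top_of_nonneg ENNReal.toReal_nonneg enorm_ne_top

theorem measurable_coeFn {X : Type*} [MeasurableSpace X] {μ : Measure X} (f : Lp ℝ p μ) :
    Measurable f := (Lp.stronglyMeasurable f).measurable

/-- Multiplication of an element of `L^p` by the indicator function of `A`. -/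
noncomputable def lpIndicator {X : Type*} [MeasurableSpace X] {μ : Measure X} {A : Set X}
    (hA : MeasurableSet A) (f : Lp ℝ p μ) : Lp ℝ p μ :=
  ((Lp.memLp f).indicator hA).toLp _

theorem coeFn_lpIndicator {X : Type*} [MeasurableSpace X] {μ : Measure X} {A : Set X}
    (hA : MeasurableSet A) (f : Lp ℝ p μ) : lpIndicator hA f =ᵐ[μ] A.indicator f :=
  MemLp.coeFn_toLp _

end Basics

/-! ### Isomorphisms of Banach lattices. -/

section LatticeIso

variable {E F H : Type*} [NormedAddCommGroup E] [NormedSpace ℝ E] [Lattice E]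
  [NormedAddCommGroup F] [NormedSpace ℝ F] [Lattice F]
  [NormedAddCommGroup H] [NormedSpace ℝ H] [Lattice H]

theorem IsLatticeIso.symm {T : E ≃ₗᵢ[ℝ] F} (hT : IsLatticeIso T) : IsLatticeIso T.symm := by
  refine fun x y => ⟨T.injective ?_, T.injective ?_⟩
  · simp [(hT _ _).1]
  · simp [(hT _ _).2]

theorem IsLatticeIso.trans {T : E ≃ₗᵢ[ℝ] F} {S : F ≃ₗᵢ[ℝ] H} (hT : IsLatticeIso T)
    (hS : IsLatticeIso S) : IsLatticeIso (T.trans S) := fun x y => by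
  simp [(hT _ _).1, (hT _ _).2, (hS _ _).1, (hS _ _).2]

theorem IsLatticeIso.le_iff {T : E ≃ₗᵢ[ℝ] F} (hT : IsLatticeIso T) {x y : E} :
    T x ≤ T y ↔ x ≤ y := by
  rw [← sup_eq_right, ← sup_eq_right, ← (hT _ _).1, T.injective.eq_iff]

theorem IsLatticeIso.nonneg_iff {T : E ≃ₗᵢ[ℝ] F} (hT : IsLatticeIso T) {x : E} :
    0 ≤ T x ↔ 0 ≤ x := by
  rw [← hT.le_iff, map_zero]

theorem IsLatticeIso.map_abs {T : E ≃ₗᵢ[ℝ] F} (hT : IsLatticeIso T) (x : E) :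
    T |x| = |T x| := by
  rw [abs, abs, (hT _ _).1, map_neg]

theorem IsLatticeIso.latDisjoint_iff {T : E ≃ₗᵢ[ℝ] F} (hT : IsLatticeIso T) {x y : E} :
    LatDisjoint (T x) (T y) ↔ LatDisjoint x y := by
  rw [LatDisjoint, LatDisjoint, ← hT.map_abs, ← hT.map_abs, ← (hT _ _).2,
    map_eq_zero_iff _ T.injective]

/-- No axiom links the order of `E` with its addition, so even this fact has to be transported from
`L^p`. -/
theorem abs_eq_zero_iff_of_isLatticeIso {p : ℝ≥0∞} {X : Type*} [MeasurableSpace X]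
    {μ : Measure X} [Fact (1 ≤ p)] {T : E ≃ₗᵢ[ℝ] Lp ℝ p μ} (hT : IsLatticeIso T) {w : E} :
    |w| = 0 ↔ w = 0 := by
  rw [← map_eq_zero_iff T T.injective, hT.map_abs, ← map_eq_zero_iff T T.injective (x := w)]
  constructor
  · intro h
    have h2 : LatDisjoint (T w) (T w) := by rw [LatDisjoint, h, inf_idem]
    rw [latDisjoint_iff_ae] at h2
    rw [Lp.eq_zero_iff_ae_eq_zero]
    filter_upwards [h2] with x hx using hx.elim id id
  · rintro h
    rw [h, abs, neg_zero, sup_idem]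

/-- A maximal disjoint set of positive elements of an `L^p` lattice has trivial disjoint
complement. -/
theorem eq_zero_of_maximal_of_latDisjoint {p : ℝ≥0∞} {X : Type*} [MeasurableSpace X]
    {μ : Measure X} [Fact (1 ≤ p)] {T : E ≃ₗᵢ[ℝ] Lp ℝ p μ} (hT : IsLatticeIso T) {S : Set E}
    (hS : Maximal IsDisjointPositive S) {w : E} (hw : ∀ e ∈ S, LatDisjoint e w) : w = 0 := by
  by_contra hw0
  have hpos : 0 < |w| := by
    refine lt_of_le_of_ne (hT.nonneg_iff.1 ?_) (fun h => hw0 ?_)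
    · rw [hT.map_abs]; exact abs_nonneg _
    · exact (abs_eq_zero_iff_of_isLatticeIso hT).1 h.symm
  have habs : ∀ x : E, LatDisjoint x w → LatDisjoint x |w| := fun x h => by
    rw [← hT.latDisjoint_iff, LatDisjoint] at h ⊢
    rwa [hT.map_abs, abs_abs]
  -- By maximality `|w|` then lies in `S`, so it is disjoint from itself.
  have hins : IsDisjointPositive (insert |w| S) := by
    refine ⟨?_, ?_⟩
    · rintro x (rfl | hx)
      exacts [hpos, hS.prop.1 x hx]
    · rw [Set.pairwise_insert]
      refine ⟨hS.prop.2, fun b hb _ => ?_⟩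
      have := habs b (hw b hb)
      exact ⟨by rwa [LatDisjoint, inf_comm], this⟩
  have hmem : |w| ∈ S := hS.le_of_ge hins (Set.subset_insert _ _) (Set.mem_insert _ _)
  have h := habs _ (hw _ hmem)
  rw [LatDisjoint, inf_idem, abs_eq_zero_iff_of_isLatticeIso hT] at h
  exact hpos.ne' h

end LatticeIso

/-- The measure space `(Y, ν)` is the direct sum of the finite measure spaces given by the fibres
of `idx`. -/
structure IsDirectSum {Y ι : Type*} [MeasurableSpace Y] (ν : Measure Y) (idx : Y → ι) : Prop where
  measurableSet_of_inter : ∀ A : Set Y, (∀ i, MeasurableSet (A ∩ idx ⁻¹' {i})) → MeasurableSet A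
  measurableSet_fibre : ∀ i, MeasurableSet (idx ⁻¹' {i})
  measure_fibre_ne_top : ∀ i, ν (idx ⁻¹' {i}) ≠ ∞
  measure_eq_tsum : ∀ A, MeasurableSet A → ν A = ∑' i, ν (A ∩ idx ⁻¹' {i})

/-! ### The direct sum of the measures `|e i| ^ p μ`. -/

section SigmaMeasure

variable {p : ℝ≥0∞} {X ι : Type*} [MeasurableSpace X] {μ : Measure X}

/-- The inclusion of the summand with index `i`. -/
abbrev sigmaIncl (i : ι) : X → Σ _ : ι, X := fun x => ⟨i, x⟩

theorem measurableSet_sigma_iff {A : Set (Σ _ : ι, X)} :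
    MeasurableSet A ↔ ∀ i, MeasurableSet (sigmaIncl i ⁻¹' A) :=
  MeasurableSpace.measurableSet_iInf

theorem measurable_sigma_iff {B : Type*} [MeasurableSpace B] {f : (Σ _ : ι, X) → B} :
    Measurable f ↔ ∀ i, Measurable fun x => f ⟨i, x⟩ :=
  ⟨fun h i _ hs => measurableSet_sigma_iff.1 (h hs) i,
    fun h _ hs => measurableSet_sigma_iff.2 fun i => h i hs⟩

theorem measurable_sigmaIncl (i : ι) : Measurable (sigmaIncl i : X → Σ _ : ι, X) :=
  fun _ hs => measurableSet_sigma_iff.1 hs i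

theorem measurable_weight (e : ι → Lp ℝ p μ) (i : ι) :
    Measurable fun x => ‖e i x‖ₑ ^ p.toReal :=
  (measurable_coeFn (e i)).enorm.pow_const _

/-- The direct sum over `i` of the measures with density `|e i| ^ p`. -/
noncomputable def sigmaMeasure (e : ι → Lp ℝ p μ) : Measure (Σ _ : ι, X) :=
  Measure.sum fun i => (μ.withDensity fun x => ‖e i x‖ₑ ^ p.toReal).map (sigmaIncl i)

theorem sigmaMeasure_apply (e : ι → Lp ℝ p μ) {A : Set (Σ _ : ι, X)} (hA : MeasurableSet A) :
    sigmaMeasure e A = ∑' i, (μ.withDensity fun x => ‖e i x‖ₑ ^ p.toReal) (sigmaIncl i ⁻¹' A) := by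
  rw [sigmaMeasure, Measure.sum_apply _ hA]
  exact tsum_congr fun i => Measure.map_apply (measurable_sigmaIncl i) hA

theorem lintegral_sigmaMeasure (e : ι → Lp ℝ p μ) {f : (Σ _ : ι, X) → ℝ≥0∞} (hf : Measurable f) :
    ∫⁻ y, f y ∂sigmaMeasure e = ∑' i, ∫⁻ x, ‖e i x‖ₑ ^ p.toReal * f ⟨i, x⟩ ∂μ := by
  rw [sigmaMeasure, lintegral_sum_measure]
  refine tsum_congr fun i => ?_
  rw [lintegral_map hf (measurable_sigmaIncl i), lintegral_withDensity_eq_lintegral_mul _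
    (measurable_weight e i) (g := fun x => f (sigmaIncl i x)) (hf.comp (measurable_sigmaIncl i))]
  rfl

theorem weight_ne_zero_iff (hp : 0 < p.toReal) {a : ℝ} : ‖a‖ₑ ^ p.toReal ≠ 0 ↔ a ≠ 0 := by
  rw [Ne, ENNReal.rpow_eq_zero_iff_of_pos hp, enorm_eq_zero]

/-- Any set with measurable slices is measurable, so null sets chosen in each summand unite to a
null set, even when there are uncountably many summands. -/
theorem ae_sigmaMeasure (hp : 0 < p.toReal) (e : ι → Lp ℝ p μ) {P : (Σ _ : ι, X) → Prop}
    (h : ∀ i, ∀ᵐ x ∂μ, e i x ≠ 0 → P ⟨i, x⟩) : ∀ᵐ y ∂sigmaMeasure e, P y := by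
  have h' : ∀ i, ∀ᵐ x ∂(μ.withDensity fun x => ‖e i x‖ₑ ^ p.toReal), P ⟨i, x⟩ := fun i => by
    rw [ae_withDensity_iff (measurable_weight e i)]
    filter_upwards [h i] with x hx h0 using hx ((weight_ne_zero_iff hp).1 h0)
  choose t ht htm ht0 using fun i => exists_measurable_superset_of_null (ae_iff.1 (h' i))
  have hm : MeasurableSet {y : Σ _ : ι, X | y.2 ∈ t y.1} := measurableSet_sigma_iff.2 fun i => htm i
  refine measure_mono_null (t := {y : Σ _ : ι, X | y.2 ∈ t y.1}) (fun y hy => ht y.1 hy) ?_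
  rw [sigmaMeasure_apply e hm, ENNReal.tsum_eq_zero]
  exact ht0

theorem measurableSet_sigma_fst (i : ι) :
    MeasurableSet (Sigma.fst ⁻¹' {i} : Set (Σ _ : ι, X)) := by
  refine measurableSet_sigma_iff.2 fun j => ?_
  by_cases h : j = i
  · convert MeasurableSet.univ; ext; simp [h]
  · convert MeasurableSet.empty; ext; simp [h]

theorem sigmaMeasure_slice (e : ι → Lp ℝ p μ) (i : ι) {A : Set (Σ _ : ι, X)}
    (hA : MeasurableSet A) :
    sigmaMeasure e (A ∩ Sigma.fst ⁻¹' {i}) =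
      (μ.withDensity fun x => ‖e i x‖ₑ ^ p.toReal) (sigmaIncl i ⁻¹' A) := by
  have hm : MeasurableSet (A ∩ Sigma.fst ⁻¹' {i}) := hA.inter (measurableSet_sigma_fst i)
  rw [sigmaMeasure_apply e hm, tsum_eq_single i]
  · congr 1; ext; simp
  · intro j hj
    convert measure_empty (μ := μ.withDensity fun x => ‖e j x‖ₑ ^ p.toReal)
    ext; simp [hj]

theorem isDirectSum_sigmaMeasure [Fact (1 ≤ p)] (hp : p ≠ ∞) (e : ι → Lp ℝ p μ) :
    IsDirectSum (sigmaMeasure e) Sigma.fst where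
  measurableSet_of_inter A hA := measurableSet_sigma_iff.2 fun i => by
    convert measurableSet_sigma_iff.1 (hA i) i using 1
    ext; simp
  measurableSet_fibre := measurableSet_sigma_fst
  measure_fibre_ne_top i := by
    have := sigmaMeasure_slice e i MeasurableSet.univ
    rw [Set.univ_inter] at this
    rw [this, Set.preimage_univ, withDensity_apply _ MeasurableSet.univ, setLIntegral_univ]
    exact lintegral_enorm_rpow_ne_top hp (e i)
  measure_eq_tsum A hA := by
    rw [sigmaMeasure_apply e hA]
    exact tsum_congr fun i => (sigmaMeasure_slice e i hA).symm

theorem measurable_sigma_div (e : ι → Lp ℝ p μ) (f : Lp ℝ p μ) :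
    Measurable fun y : Σ _ : ι, X => f y.2 / e y.1 y.2 :=
  measurable_sigma_iff.2 fun i => (measurable_coeFn f).div (measurable_coeFn (e i))

end SigmaMeasure

/-! ### Dividing by a complete disjoint system. -/

section WeightedIso

variable {p : ℝ≥0∞} [Fact (1 ≤ p)] {X ι : Type*} [MeasurableSpace X] {μ : Measure X}

/-- The finite measure `|f| ^ p μ` charges only countably many of the disjoint supports. The part of
`f` off their union is disjoint from every `e i`, hence zero. -/
theorem tsum_setLIntegral_support_eq (hp : p ≠ ∞) {e : ι → Lp ℝ p μ}
    (hd : Pairwise fun i j => LatDisjoint (e i) (e j))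
    (hc : ∀ w, (∀ i, LatDisjoint (e i) w) → w = 0) (f : Lp ℝ p μ) :
    ∑' i, ∫⁻ x in {x | e i x ≠ 0}, ‖f x‖ₑ ^ p.toReal ∂μ = ∫⁻ x, ‖f x‖ₑ ^ p.toReal ∂μ := by
  have hp0 := toReal_pos_of_fact hp
  have hfm : Measurable fun x => ‖f x‖ₑ ^ p.toReal := (measurable_coeFn f).enorm.pow_const _
  set A : ι → Set X := fun i => {x | e i x ≠ 0} with hA
  have hAm : ∀ i, MeasurableSet (A i) := fun i =>
    measurable_coeFn (e i) (measurableSet_singleton (0 : ℝ)).compl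
  set ρ : Measure X := μ.withDensity fun x => ‖f x‖ₑ ^ p.toReal with hρ
  have hρA : ∀ B, MeasurableSet B → ρ B = ∫⁻ x in B, ‖f x‖ₑ ^ p.toReal ∂μ :=
    fun B hB => withDensity_apply _ hB
  have hfin : IsFiniteMeasure ρ := isFiniteMeasure_withDensity (lintegral_enorm_rpow_ne_top hp f)
  have hdisj : Pairwise (Function.onFun (AEDisjoint ρ) A) := fun i j hij => by
    refine withDensity_absolutelyContinuous μ _ ?_
    have := latDisjoint_iff_ae.1 (hd hij)
    rw [ae_iff] at this
    refine measure_mono_null ?_ this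
    rintro x ⟨h1, h2⟩ (h | h)
    exacts [h1 h, h2 h]
  set K : Set ι := {i | 0 < ρ (A i)} with hK
  have hKc : K.Countable :=
    Measure.countable_meas_pos_of_disjoint_iUnion₀ (fun i => (hAm i).nullMeasurableSet) hdisj
  have : Countable K := hKc
  have hUm : MeasurableSet (⋃ i : K, A i) := MeasurableSet.iUnion fun i => hAm i
  have hzero : lpIndicator hUm.compl f = 0 := by
    refine hc _ fun i => latDisjoint_iff_ae.2 ?_
    by_cases hi : i ∈ K
    · filter_upwards [coeFn_lpIndicator hUm.compl f] with x hx
      by_cases h0 : e i x = 0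
      · exact Or.inl h0
      · right
        rw [hx, Set.indicator_of_notMem]
        exact fun h => h (Set.mem_iUnion.2 ⟨⟨i, hi⟩, h0⟩)
    -- For an index outside `K`, already `f` itself vanishes almost everywhere on the support of `e
    -- i`.
    · have h0 : ρ (A i) = 0 := le_antisymm (not_lt.1 hi) bot_le
      rw [hρA _ (hAm i), lintegral_eq_zero_iff hfm, Filter.EventuallyEq,
        ae_restrict_iff' (hAm i)] at h0
      filter_upwards [coeFn_lpIndicator hUm.compl f, h0] with x hx h1
      by_cases h2 : e i x = 0
      · exact Or.inl h2
      · right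
        have : f x = 0 := by
          by_contra h3
          exact (weight_ne_zero_iff hp0).2 h3 (h1 h2)
        rw [hx]
        by_cases h4 : x ∈ (⋃ i : K, A i)ᶜ
        · rw [Set.indicator_of_mem h4, this]
        · rw [Set.indicator_of_notMem h4]
  have hcompl : ρ (⋃ i : K, A i)ᶜ = 0 := by
    rw [hρA _ hUm.compl, lintegral_eq_zero_iff hfm, Filter.EventuallyEq,
      ae_restrict_iff' hUm.compl]
    filter_upwards [coeFn_lpIndicator hUm.compl f, Lp.eq_zero_iff_ae_eq_zero.1 hzero]
      with x h1 h2 h3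
    rw [h2, Set.indicator_of_mem h3] at h1
    rw [← h1]
    simp [hp0]
  calc ∑' i, ∫⁻ x in A i, ‖f x‖ₑ ^ p.toReal ∂μ = ∑' i, ρ (A i) :=
        tsum_congr fun i => (hρA _ (hAm i)).symm
    _ = ∑' i : K, ρ (A i) := by
        refine (tsum_subtype_eq_of_support_subset ?_).symm
        intro i hi
        exact pos_iff_ne_zero.2 hi
    _ = ρ (⋃ i : K, A i) := (measure_iUnion₀ (f := fun i : K => A i)
        (fun i j hij => hdisj (Subtype.coe_injective.ne hij))
        fun i => (hAm i).nullMeasurableSet).symm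
    _ = ρ Set.univ := by
        rw [← measure_add_measure_compl hUm, hcompl, add_zero]
    _ = _ := by rw [hρA _ MeasurableSet.univ, setLIntegral_univ]

/-- The weight `|e i| ^ p` cancels the denominator on the support of `e i` and annihilates the
integrand elsewhere. -/
theorem eLpNorm_sigma_div (hp : p ≠ ∞) {e : ι → Lp ℝ p μ}
    (hd : Pairwise fun i j => LatDisjoint (e i) (e j))
    (hc : ∀ w, (∀ i, LatDisjoint (e i) w) → w = 0) (f : Lp ℝ p μ) :
    eLpNorm (fun y : Σ _ : ι, X => f y.2 / e y.1 y.2) p (sigmaMeasure e) = eLpNorm f p μ := by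
  have hp0 := toReal_pos_of_fact hp
  have h1 : p ≠ 0 := (zero_lt_one.trans_le (Fact.out : 1 ≤ p)).ne'
  rw [eLpNorm_eq_lintegral_rpow_enorm_toReal h1 hp, eLpNorm_eq_lintegral_rpow_enorm_toReal h1 hp,
    lintegral_sigmaMeasure e ((measurable_sigma_div e f).enorm.pow_const _),
    ← tsum_setLIntegral_support_eq hp hd hc f]
  congr 2
  ext i
  have hm : MeasurableSet {x | e i x ≠ 0} :=
    measurable_coeFn (e i) (measurableSet_singleton (0 : ℝ)).compl
  rw [← lintegral_indicator hm]
  refine lintegral_congr fun x => ?_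
  by_cases h : e i x = 0
  · rw [Set.indicator_of_notMem (by simpa using h), h]
    simp [hp0]
  · rw [Set.indicator_of_mem (show x ∈ {x | e i x ≠ 0} from h),
      ← ENNReal.mul_rpow_of_nonneg _ _ hp0.le, ← enorm_mul, mul_div_cancel₀ _ h]

theorem memLp_sigma_div (hp : p ≠ ∞) {e : ι → Lp ℝ p μ}
    (hd : Pairwise fun i j => LatDisjoint (e i) (e j))
    (hc : ∀ w, (∀ i, LatDisjoint (e i) w) → w = 0) (f : Lp ℝ p μ) :
    MemLp (fun y : Σ _ : ι, X => f y.2 / e y.1 y.2) p (sigmaMeasure e) :=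
  ⟨(measurable_sigma_div e f).aestronglyMeasurable, by
    rw [eLpNorm_sigma_div hp hd hc]; exact Lp.eLpNorm_lt_top f⟩

/-- The map `f ↦ f / e i` onto the direct sum of the weighted spaces, as a linear isometry. -/
noncomputable def sigmaDiv (hp : p ≠ ∞) {e : ι → Lp ℝ p μ}
    (hd : Pairwise fun i j => LatDisjoint (e i) (e j))
    (hc : ∀ w, (∀ i, LatDisjoint (e i) w) → w = 0) : Lp ℝ p μ →ₗᵢ[ℝ] Lp ℝ p (sigmaMeasure e) where
  toFun f := (memLp_sigma_div hp hd hc f).toLp _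
  map_add' f g := by
    rw [← MemLp.toLp_add, MemLp.toLp_eq_toLp_iff]
    refine ae_sigmaMeasure (toReal_pos_of_fact hp) e fun i => ?_
    filter_upwards [Lp.coeFn_add f g] with x hx _
    change (f + g : Lp ℝ p μ) x / e i x = f x / e i x + g x / e i x
    rw [hx, Pi.add_apply, add_div]
  map_smul' c f := by
    rw [RingHom.id_apply, ← MemLp.toLp_const_smul, MemLp.toLp_eq_toLp_iff]
    refine ae_sigmaMeasure (toReal_pos_of_fact hp) e fun i => ?_
    filter_upwards [Lp.coeFn_smul c f] with x hx _
    change (c • f : Lp ℝ p μ) x / e i x = c * (f x / e i x)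
    rw [hx, Pi.smul_apply, smul_eq_mul, mul_div_assoc]
  norm_map' f := by
    change ‖(memLp_sigma_div hp hd hc f).toLp _‖ = _
    rw [Lp.norm_toLp, eLpNorm_sigma_div hp hd hc, Lp.norm_def]

theorem coeFn_sigmaDiv (hp : p ≠ ∞) {e : ι → Lp ℝ p μ}
    (hd : Pairwise fun i j => LatDisjoint (e i) (e j))
    (hc : ∀ w, (∀ i, LatDisjoint (e i) w) → w = 0) (f : Lp ℝ p μ) :
    sigmaDiv hp hd hc f =ᵐ[sigmaMeasure e] fun y => f y.2 / e y.1 y.2 :=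
  (memLp_sigma_div hp hd hc f).coeFn_toLp

/-- Indicator functions of measurable subsets of a single summand are in the range. -/
theorem sigmaDiv_smul_lpIndicator (hp : p ≠ ∞) {e : ι → Lp ℝ p μ}
    (hd : Pairwise fun i j => LatDisjoint (e i) (e j))
    (hc : ∀ w, (∀ i, LatDisjoint (e i) w) → w = 0) (i : ι) (c : ℝ) {S : Set (Σ _ : ι, X)}
    (hS : MeasurableSet S) :
    sigmaDiv hp hd hc (c • lpIndicator (measurable_sigmaIncl i hS) (e i)) =ᵐ[sigmaMeasure e]
      (S ∩ Sigma.fst ⁻¹' {i}).indicator fun _ => c := by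
  refine (coeFn_sigmaDiv hp hd hc _).trans (ae_sigmaMeasure (toReal_pos_of_fact hp) e fun j => ?_)
  -- By disjointness, `e i` contributes nothing to the other summands.
  have hdj : ∀ᵐ x ∂μ, j ≠ i → e j x = 0 ∨ e i x = 0 := by
    by_cases hji : j = i
    · exact Filter.Eventually.of_forall fun x h => absurd hji h
    · filter_upwards [latDisjoint_iff_ae.1 (hd hji)] with x hx _ using hx
  filter_upwards [Lp.coeFn_smul c (lpIndicator (measurable_sigmaIncl i hS) (e i)),
    coeFn_lpIndicator (measurable_sigmaIncl i hS) (e i), hdj] with x h1 h2 h3 h4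
  simp only [h1, Pi.smul_apply, h2, smul_eq_mul]
  by_cases hji : j = i
  · subst hji
    by_cases hx : (⟨j, x⟩ : Σ _ : ι, X) ∈ S
    · rw [Set.indicator_of_mem (show x ∈ sigmaIncl j ⁻¹' S from hx),
        Set.indicator_of_mem (show (⟨j, x⟩ : Σ _ : ι, X) ∈ S ∩ Sigma.fst ⁻¹' {j} from ⟨hx, rfl⟩),
        mul_div_cancel_right₀ _ h4]
    · rw [Set.indicator_of_notMem (show x ∉ sigmaIncl j ⁻¹' S from hx),
        Set.indicator_of_notMem (fun h => hx h.1), mul_zero, zero_div]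
  · rw [Set.indicator_of_notMem (s := S ∩ Sigma.fst ⁻¹' {i}) (fun h => hji h.2)]
    have := (h3 hji).resolve_left h4
    simp [this]

/-- The range of an isometry of a complete space is closed, so indicators of sets `S` of finite
measure suffice. These are limits of indicators of the part of `S` in finitely many summands, which
come from truncations of the `e i`. -/
theorem sigmaDiv_surjective (hp : p ≠ ∞) {e : ι → Lp ℝ p μ}
    (hd : Pairwise fun i j => LatDisjoint (e i) (e j))
    (hc : ∀ w, (∀ i, LatDisjoint (e i) w) → w = 0) :
    Function.Surjective (sigmaDiv hp hd hc) := by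
  set J := sigmaDiv hp hd hc with hJ
  have hclosed : IsClosed (Set.range J) := J.isometry.isClosedEmbedding.isClosed_range
  have hsum := isDirectSum_sigmaMeasure hp e
  suffices h : ∀ f, f ∈ Set.range J from h
  refine Lp.induction hp _ ?_ ?_ hclosed
  · intro c S hS hSfin
    rw [Lp.simpleFunc.coe_indicatorConst]
    let t : Finset ι → Set (Σ _ : ι, X) := fun F => ⋃ i ∈ F, S ∩ Sigma.fst ⁻¹' {i}
    have hti : ∀ i, MeasurableSet (S ∩ Sigma.fst ⁻¹' {i}) := fun i =>
      hS.inter (measurableSet_sigma_fst i)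
    have htm : ∀ F, MeasurableSet (t F) := fun F => F.measurableSet_biUnion fun i _ => hti i
    have htS : ∀ F, t F ⊆ S := fun F => Set.iUnion₂_subset fun i _ => Set.inter_subset_left
    have htfin : ∀ F, sigmaMeasure e (t F) ≠ ∞ := fun F =>
      ((measure_mono (htS F)).trans_lt hSfin).ne
    refine hclosed.mem_of_tendsto (tendsto_indicatorConstLp_set (hp₁ := inferInstance)
      (hs := hS) (hμs := hSfin.ne) (c := c) (ht := htm) (hμt := htfin) (l := Filter.atTop) hp ?_)
      (Filter.Eventually.of_forall fun F => ?_)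
    -- The measure of `S \ t F` is a tail of the convergent series for the measure of `S`.
    · have h1 := hsum.measure_eq_tsum S hS
      have h2 := ENNReal.tendsto_tsum_compl_atTop_zero (h1 ▸ hSfin.ne)
      refine h2.congr fun F => ?_
      have hdiff : MeasurableSet (S \ t F) := hS.diff (htm F)
      rw [Set.symmDiff_def, Set.sdiff_eq_empty.2 (htS F), Set.empty_union,
        hsum.measure_eq_tsum _ hdiff,
        ← tsum_subtype_eq_of_support_subset (s := {i | i ∉ F})]
      · refine tsum_congr fun i => ?_
        congr 1
        ext y
        simp only [Set.mem_inter_iff, Set.mem_preimage, Set.mem_singleton_iff, Set.mem_sdiff, t,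
          Set.mem_iUnion, not_exists]
        refine ⟨fun h => ⟨⟨h.1, fun j hj hj2 => i.2 ?_⟩, h.2⟩, fun h => ⟨h.1.1, h.2⟩⟩
        rw [← h.2, hj2.2]; exact hj
      · intro i hi hiF
        refine hi (measure_mono_null (t := ∅) ?_ measure_empty)
        rintro y ⟨⟨h1, h2⟩, h3⟩
        exact h2 (Set.mem_biUnion hiF ⟨h1, h3⟩)
    · refine ⟨∑ i ∈ F, c • lpIndicator (measurable_sigmaIncl i hS) (e i), ?_⟩
      rw [map_sum]
      apply Lp.ext
      refine Filter.EventuallyEq.trans ?_ indicatorConstLp_coeFn.symm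
      refine (Lp.coeFn_fun_finsetSum F _).trans ?_
      have : ∀ᵐ y ∂sigmaMeasure e, ∀ i ∈ F,
          J (c • lpIndicator (measurable_sigmaIncl i hS) (e i)) y =
            (S ∩ Sigma.fst ⁻¹' {i}).indicator (fun _ => c) y :=
        (Filter.eventually_all_finset F).2 fun i _ => sigmaDiv_smul_lpIndicator hp hd hc i c hS
      filter_upwards [this] with y hy
      rw [Finset.sum_congr rfl hy]
      by_cases hyt : y ∈ t F
      · rw [Set.indicator_of_mem hyt]
        simp only [t, Set.mem_iUnion] at hyt
        obtain ⟨i, hi, hyi⟩ := hyt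
        rw [Finset.sum_eq_single_of_mem i hi, Set.indicator_of_mem hyi]
        intro j _ hji
        exact Set.indicator_of_notMem (fun h => hji (h.2.symm.trans hyi.2)) _
      · rw [Set.indicator_of_notMem hyt]
        refine Finset.sum_eq_zero fun i hi => Set.indicator_of_notMem (fun h => hyt ?_) _
        exact Set.mem_biUnion hi h
  · rintro f g hf hg - ⟨a, ha⟩ ⟨b, hb⟩
    exact ⟨a + b, by rw [map_add, ha, hb]⟩

/-- An `L^p` space with a complete disjoint system is isomorphic to the `L^p` space of a direct sum
of finite measure spaces in such a way that the system corresponds to the units of the summands. -/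
theorem exists_isDirectSum_latticeIso (hp : p ≠ ∞) {e : ι → Lp ℝ p μ} (he : ∀ i, 0 ≤ e i)
    (hd : Pairwise fun i j => LatDisjoint (e i) (e j))
    (hc : ∀ w, (∀ i, LatDisjoint (e i) w) → w = 0) :
    ∃ (ν : Measure (Σ _ : ι, X)) (J : Lp ℝ p μ ≃ₗᵢ[ℝ] Lp ℝ p ν), IsDirectSum ν Sigma.fst ∧
      IsLatticeIso J ∧ ∀ i, J (e i) =ᵐ[ν] (Sigma.fst ⁻¹' {i}).indicator fun _ => 1 := by
  have hp0 := toReal_pos_of_fact hp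
  refine ⟨sigmaMeasure e, LinearIsometryEquiv.ofSurjective (sigmaDiv hp hd hc)
    (sigmaDiv_surjective hp hd hc), isDirectSum_sigmaMeasure hp e, ?_, fun i => ?_⟩
  · intro f g
    have hpos : ∀ i, ∀ᵐ x ∂μ, 0 ≤ e i x := fun i => by
      filter_upwards [(Lp.coeFn_le _ _).2 (he i), Lp.coeFn_zero ℝ p μ] with x h1 h2
      rwa [h2] at h1
    simp only [LinearIsometryEquiv.coe_ofSurjective]
    refine ⟨Lp.ext ?_, Lp.ext ?_⟩
    · refine (coeFn_sigmaDiv hp hd hc _).trans ?_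
      filter_upwards [Lp.coeFn_sup (sigmaDiv hp hd hc f) (sigmaDiv hp hd hc g),
        coeFn_sigmaDiv hp hd hc f, coeFn_sigmaDiv hp hd hc g,
        ae_sigmaMeasure hp0 e (P := fun y => 0 ≤ e y.1 y.2 ∧ (f ⊔ g : Lp ℝ p μ) y.2 = f y.2 ⊔ g y.2)
          fun i => by filter_upwards [hpos i, Lp.coeFn_sup f g] with x h1 h2 _ using ⟨h1, h2⟩]
        with y h1 h2 h3 h4
      rw [h1, Pi.sup_apply, h2, h3, h4.2, max_div_div_right h4.1]
    · refine (coeFn_sigmaDiv hp hd hc _).trans ?_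
      filter_upwards [Lp.coeFn_inf (sigmaDiv hp hd hc f) (sigmaDiv hp hd hc g),
        coeFn_sigmaDiv hp hd hc f, coeFn_sigmaDiv hp hd hc g,
        ae_sigmaMeasure hp0 e (P := fun y => 0 ≤ e y.1 y.2 ∧ (f ⊓ g : Lp ℝ p μ) y.2 = f y.2 ⊓ g y.2)
          fun i => by filter_upwards [hpos i, Lp.coeFn_inf f g] with x h1 h2 _ using ⟨h1, h2⟩]
        with y h1 h2 h3 h4
      rw [h1, Pi.inf_apply, h2, h3, h4.2, min_div_div_right h4.1]
  · have h := sigmaDiv_smul_lpIndicator hp hd hc i 1 MeasurableSet.univ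
    have h2 : lpIndicator (measurable_sigmaIncl i MeasurableSet.univ) (e i) = e i := by
      apply Lp.ext
      refine (coeFn_lpIndicator _ _).trans ?_
      simp
    rwa [one_smul, h2, Set.univ_inter] at h

end WeightedIso

/-! ### Gluing over a direct sum of finite measure spaces. -/

namespace IsDirectSum

variable {Y ι : Type*} [MeasurableSpace Y] {ν : Measure Y} {idx : Y → ι}

theorem measurable_glue (h : IsDirectSum ν idx) {B : Type*} [MeasurableSpace B] {F : ι → Y → B}
    (hF : ∀ i, Measurable (F i)) : Measurable fun y => F (idx y) y := by
  refine fun s hs => h.measurableSet_of_inter _ fun i => ?_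
  convert (hF i hs).inter (h.measurableSet_fibre i) using 1
  ext y
  simp only [Set.mem_inter_iff, Set.mem_preimage, Set.mem_singleton_iff, and_congr_left_iff]
  rintro rfl
  rfl

/-- Only the part of the `i`-th exceptional set inside the `i`-th fibre matters, so uncountably many
exceptional sets do no harm. -/
theorem ae_of_fibres (h : IsDirectSum ν idx) {P : Y → Prop}
    (hP : ∀ i, ∀ᵐ y ∂ν, idx y = i → P y) : ∀ᵐ y ∂ν, P y := by
  choose t ht htm ht0 using fun i => exists_measurable_superset_of_null (ae_iff.1 (hP i))
  have hfib : ∀ i, {y | y ∈ t (idx y)} ∩ idx ⁻¹' {i} = t i ∩ idx ⁻¹' {i} := fun i => by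
    ext y
    simp only [Set.mem_inter_iff, Set.mem_ofPred_eq, Set.mem_preimage, Set.mem_singleton_iff,
      and_congr_left_iff]
    rintro rfl
    rfl
  have hm : MeasurableSet {y | y ∈ t (idx y)} := h.measurableSet_of_inter _ fun i => by
    rw [hfib]
    exact (htm i).inter (h.measurableSet_fibre i)
  refine measure_mono_null (t := {y | y ∈ t (idx y)})
    (fun y hy => ht (idx y) fun hy2 => hy (hy2 rfl)) ?_
  rw [h.measure_eq_tsum _ hm, ENNReal.tsum_eq_zero]
  intro i
  rw [hfib]
  exact measure_inter_null_of_null_left _ (ht0 i)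

theorem setLIntegral_eq_tsum (h : IsDirectSum ν idx) {A : Set Y} (hA : MeasurableSet A)
    (f : Y → ℝ≥0∞) : ∫⁻ y in A, f y ∂ν = ∑' i, ∫⁻ y in A ∩ idx ⁻¹' {i}, f y ∂ν := by
  rw [← lintegral_sum_measure]
  congr 1
  ext B hB
  rw [Measure.restrict_apply hB, Measure.sum_apply _ hB, h.measure_eq_tsum _ (hB.inter hA)]
  exact tsum_congr fun i => by rw [Measure.restrict_apply hB, Set.inter_assoc]

/-- A disjoint family of functions can be glued together, even if it is uncountable. -/
theorem exists_glue (h : IsDirectSum ν idx) {κ : Type*} {f : κ → Y → ℝ≥0∞}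
    (hf : ∀ j, Measurable (f j)) (hd : Pairwise fun j k => ∀ᵐ y ∂ν, f j y = 0 ∨ f k y = 0)
    (hfin : ∀ j, ∀ᵐ y ∂ν, f j y ≠ ∞) :
    ∃ d : Y → ℝ≥0∞, Measurable d ∧ (∀ᵐ y ∂ν, d y ≠ ∞) ∧
      (∀ j, ∀ᵐ y ∂ν, f j y ≠ 0 → d y = f j y) ∧
      ∀ A, MeasurableSet A → ∫⁻ y in A, d y ∂ν = ∑' j, ∫⁻ y in A, f j y ∂ν := by
  have hsm : ∀ j, MeasurableSet {y | f j y ≠ 0} := fun j =>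
    hf j (measurableSet_singleton (0 : ℝ≥0∞)).compl
  -- The indices of the functions that are not almost everywhere zero on the fibre of `i`; countably
  -- many, as the fibre has finite measure and the supports are disjoint.
  let K : ι → Set κ := fun i => {j | 0 < ν.restrict (idx ⁻¹' {i}) {y | f j y ≠ 0}}
  have hK : ∀ i, (K i).Countable := fun i => by
    have : IsFiniteMeasure (ν.restrict (idx ⁻¹' {i})) :=
      isFiniteMeasure_restrict.2 (h.measure_fibre_ne_top i)
    refine Measure.countable_meas_pos_of_disjoint_iUnion₀
      (fun j => (hsm j).nullMeasurableSet) fun j k hjk => ?_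
    refine Measure.absolutelyContinuous_of_le Measure.restrict_le_self ?_
    refine measure_mono_null ?_ (ae_iff.1 (hd hjk))
    rintro y ⟨h1, h2⟩ (h | h)
    exacts [h1 h, h2 h]
  have hKi : ∀ i, Countable (K i) := fun i => (hK i).to_subtype
  have hnotK : ∀ i j, j ∉ K i → ∀ᵐ y ∂ν, idx y = i → f j y = 0 := fun i j hj => by
    have h0 : ν.restrict (idx ⁻¹' {i}) {y | f j y ≠ 0} = 0 := le_antisymm (not_lt.1 hj) bot_le
    exact (ae_restrict_iff' (h.measurableSet_fibre i)).1 (ae_iff.2 h0)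
  -- Restricting the sum to `K (idx y)` makes it countable, hence measurable; almost everywhere at
  -- most one term is non-zero.
  let d : Y → ℝ≥0∞ := fun y => ∑' j : K (idx y), f j y
  have hdm : Measurable d := h.measurable_glue (F := fun i y => ∑' j : K i, f j y) fun i =>
    Measurable.tsum fun j => hf j
  have hdisj : ∀ᵐ y ∂ν, ∀ j k : K (idx y), j ≠ k → f j y = 0 ∨ f k y = 0 := by
    refine h.ae_of_fibres fun i => ?_
    have : ∀ᵐ y ∂ν, ∀ j k : K i, j ≠ k → f j y = 0 ∨ f k y = 0 := by
      rw [ae_all_iff]; intro j; rw [ae_all_iff]; intro k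
      by_cases hjk : j = k
      · exact Filter.Eventually.of_forall fun y h => absurd hjk h
      · filter_upwards [hd (Subtype.coe_injective.ne hjk)] with y hy _ using hy
    filter_upwards [this] with y hy
    rintro rfl
    exact hy
  have hsingle : ∀ᵐ y ∂ν, ∀ j : K (idx y), f j y ≠ 0 → d y = f j y := by
    filter_upwards [hdisj] with y hy j hj
    exact tsum_eq_single j fun k hk => (hy k j hk).resolve_right hj
  refine ⟨d, hdm, ?_, fun j => ?_, fun A hA => ?_⟩
  · have : ∀ᵐ y ∂ν, ∀ j : K (idx y), f j y ≠ ∞ := by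
      refine h.ae_of_fibres fun i => ?_
      have : ∀ᵐ y ∂ν, ∀ j : K i, f j y ≠ ∞ := ae_all_iff.2 fun j => hfin j
      filter_upwards [this] with y hy
      rintro rfl
      exact hy
    filter_upwards [hsingle, this] with y h1 h2
    by_cases h0 : ∀ j : K (idx y), f j y = 0
    · simp [d, h0]
    · push Not at h0
      obtain ⟨j, hj⟩ := h0
      rw [h1 j hj]
      exact h2 j
  · refine h.ae_of_fibres fun i => ?_
    by_cases hj : j ∈ K i
    · filter_upwards [hsingle] with y hy
      rintro rfl
      exact hy ⟨j, hj⟩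
    · filter_upwards [hnotK i j hj] with y hy hi h0
      exact absurd (hy hi) h0
  · calc ∫⁻ y in A, d y ∂ν = ∑' i, ∫⁻ y in A ∩ idx ⁻¹' {i}, d y ∂ν := h.setLIntegral_eq_tsum hA d
      _ = ∑' i, ∑' j, ∫⁻ y in A ∩ idx ⁻¹' {i}, f j y ∂ν := by
          refine tsum_congr fun i => ?_
          have hm : MeasurableSet (A ∩ idx ⁻¹' {i}) := hA.inter (h.measurableSet_fibre i)
          calc ∫⁻ y in A ∩ idx ⁻¹' {i}, d y ∂ν
              = ∫⁻ y in A ∩ idx ⁻¹' {i}, ∑' j : K i, f j y ∂ν := by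
                refine setLIntegral_congr_fun hm ?_
                rintro y ⟨-, rfl⟩
                rfl
            _ = ∑' j : K i, ∫⁻ y in A ∩ idx ⁻¹' {i}, f j y ∂ν :=
                lintegral_tsum fun j => (hf j).aemeasurable
            _ = _ := by
                refine tsum_subtype_eq_of_support_subset
                  (f := fun j => ∫⁻ y in A ∩ idx ⁻¹' {i}, f j y ∂ν) fun j hj => ?_
                by_contra hjK
                refine hj ?_
                change ∫⁻ y in A ∩ idx ⁻¹' {i}, f j y ∂ν = 0
                rw [lintegral_eq_zero_iff (hf j), Filter.EventuallyEq, ae_restrict_iff' hm]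
                filter_upwards [hnotK i j hjK] with y hy hy2 using hy hy2.2
      _ = ∑' j, ∑' i, ∫⁻ y in A ∩ idx ⁻¹' {i}, f j y ∂ν := ENNReal.tsum_comm
      _ = _ := tsum_congr fun j => (h.setLIntegral_eq_tsum hA (f j)).symm

/-- The unit of the summand with index `i`. -/
noncomputable def unit (h : IsDirectSum ν idx) (p : ℝ≥0∞) (i : ι) : Lp ℝ p ν :=
  indicatorConstLp p (h.measurableSet_fibre i) (h.measure_fibre_ne_top i) 1

theorem unit_apply (h : IsDirectSum ν idx) {p : ℝ≥0∞} (i : ι) :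
    ∀ᵐ y ∂ν, idx y = i → h.unit p i y = 1 := by
  filter_upwards [indicatorConstLp_coeFn (p := p) (hs := h.measurableSet_fibre i)
    (hμs := h.measure_fibre_ne_top i) (c := (1 : ℝ))] with y hy hi
  rw [unit, hy, Set.indicator_of_mem (by exact hi)]

end IsDirectSum

/-! ### Image measures under maps that generate the measurable sets up to null sets. -/

section Lift

variable {Y Z : Type*} [MeasurableSpace Y] [MeasurableSpace Z] {ν : Measure Y} {ψ : Y → Z}

/-- The hypothesis `hl` is the case of indicator functions; sums and monotone limits give the rest.
-/
theorem exists_measurable_comp_ae_eq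
    (hl : ∀ S, MeasurableSet S → ∃ C, MeasurableSet C ∧ ∀ᵐ y ∂ν, ψ y ∈ C ↔ y ∈ S)
    {f : Y → ℝ≥0∞} (hf : Measurable f) :
    ∃ d : Z → ℝ≥0∞, Measurable d ∧ ∀ᵐ y ∂ν, d (ψ y) = f y := by
  refine Measurable.ennreal_induction
    (motive := fun f => ∃ d : Z → ℝ≥0∞, Measurable d ∧ ∀ᵐ y ∂ν, d (ψ y) = f y) ?_ ?_ ?_ hf
  · intro c s hs
    obtain ⟨C, hC, hCs⟩ := hl s hs
    refine ⟨C.indicator fun _ => c, measurable_const.indicator hC, ?_⟩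
    filter_upwards [hCs] with y hy
    by_cases h : y ∈ s
    · rw [Set.indicator_of_mem h, Set.indicator_of_mem (hy.2 h)]
    · rw [Set.indicator_of_notMem h, Set.indicator_of_notMem (fun h' => h (hy.1 h'))]
  · rintro f g - - - ⟨a, ha, hfa⟩ ⟨b, hb, hgb⟩
    refine ⟨a + b, ha.add hb, ?_⟩
    filter_upwards [hfa, hgb] with y h1 h2
    rw [Pi.add_apply, Pi.add_apply, h1, h2]
  · intro f _ _ hf
    choose a ha hfa using hf
    refine ⟨fun z => ⨆ n, a n z, Measurable.iSup ha, ?_⟩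
    filter_upwards [ae_all_iff.2 hfa] with y hy
    simp only [hy]

theorem exists_measurable_real_comp_ae_eq
    (hl : ∀ S, MeasurableSet S → ∃ C, MeasurableSet C ∧ ∀ᵐ y ∂ν, ψ y ∈ C ↔ y ∈ S)
    {f : Y → ℝ} (hf : Measurable f) :
    ∃ d : Z → ℝ, Measurable d ∧ ∀ᵐ y ∂ν, d (ψ y) = f y := by
  obtain ⟨a, ha, hfa⟩ := exists_measurable_comp_ae_eq hl hf.ennreal_ofReal
  obtain ⟨b, hb, hfb⟩ := exists_measurable_comp_ae_eq hl hf.neg.ennreal_ofReal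
  refine ⟨fun z => (a z).toReal - (b z).toReal, ha.ennreal_toReal.sub hb.ennreal_toReal, ?_⟩
  filter_upwards [hfa, hfb] with y h1 h2
  simp only [h1, h2, ENNReal.toReal_ofReal', Pi.neg_apply]
  rcases le_total 0 (f y) with h | h
  · rw [max_eq_left h, max_eq_right (by linarith), sub_zero]
  · rw [max_eq_right h, max_eq_left (by linarith), zero_sub, neg_neg]

/-- Composition with `ψ` is isometric for the image measure in any case; `hl` makes it surjective.
-/
theorem exists_latticeIso_map {p : ℝ≥0∞} [Fact (1 ≤ p)] (hψ : Measurable ψ)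
    (hl : ∀ S, MeasurableSet S → ∃ C, MeasurableSet C ∧ ∀ᵐ y ∂ν, ψ y ∈ C ↔ y ∈ S) :
    ∃ Θ : Lp ℝ p (ν.map ψ) ≃ₗᵢ[ℝ] Lp ℝ p ν, IsLatticeIso Θ ∧ ∀ f, Θ f =ᵐ[ν] fun y => f (ψ y) := by
  have hmp : MeasurePreserving ψ ν (ν.map ψ) := hψ.measurePreserving ν
  have hcoe : ∀ f : Lp ℝ p (ν.map ψ), Lp.compMeasurePreservingₗᵢ ℝ ψ hmp f =ᵐ[ν] f ∘ ψ :=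
    fun f => Lp.coeFn_compMeasurePreserving f hmp
  have hsurj : Function.Surjective (Lp.compMeasurePreservingₗᵢ (E := ℝ) (p := p) ℝ ψ hmp) := by
    intro f
    obtain ⟨d, hd, hdf⟩ := exists_measurable_real_comp_ae_eq hl (measurable_coeFn f)
    have hmem : MemLp d p (ν.map ψ) := by
      rw [memLp_map_measure_iff hd.aestronglyMeasurable hψ.aemeasurable]
      exact (memLp_congr_ae hdf).2 (Lp.memLp f)
    refine ⟨hmem.toLp d, Lp.ext ?_⟩
    filter_upwards [hcoe (hmem.toLp d), hmp.quasiMeasurePreserving.ae hmem.coeFn_toLp, hdf]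
      with y h1 h2 h3
    rw [h1, Function.comp_apply, h2, h3]
  refine ⟨LinearIsometryEquiv.ofSurjective _ hsurj, fun f g => ⟨Lp.ext ?_, Lp.ext ?_⟩, hcoe⟩
  · simp only [LinearIsometryEquiv.coe_ofSurjective]
    filter_upwards [hcoe (f ⊔ g), hcoe f, hcoe g,
      Lp.coeFn_sup (Lp.compMeasurePreservingₗᵢ ℝ ψ hmp f)
        (Lp.compMeasurePreservingₗᵢ ℝ ψ hmp g),
      hmp.quasiMeasurePreserving.ae (Lp.coeFn_sup f g)]
      with y h1 h2 h3 h4 h5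
    rw [h1, h4, Function.comp_apply, h5, Pi.sup_apply, Pi.sup_apply, h2, h3]
    rfl
  · simp only [LinearIsometryEquiv.coe_ofSurjective]
    filter_upwards [hcoe (f ⊓ g), hcoe f, hcoe g,
      Lp.coeFn_inf (Lp.compMeasurePreservingₗᵢ ℝ ψ hmp f)
        (Lp.compMeasurePreservingₗᵢ ℝ ψ hmp g),
      hmp.quasiMeasurePreserving.ae (Lp.coeFn_inf f g)]
      with y h1 h2 h3 h4 h5
    rw [h1, h4, Function.comp_apply, h5, Pi.inf_apply, Pi.inf_apply, h2, h3]
    rfl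

end Lift

/-- The band projections of `E`, described by disjointness alone. -/
def BandProj (E : Type*) [AddGroup E] [Lattice E] : Type _ :=
  {P : E → E // ∀ f g, LatDisjoint (P f) (g - P g)}

/-- The measure space on which `E` is represented: the two-valued functions on the set of band
projections. -/
abbrev BandSpace (E : Type*) [AddGroup E] [Lattice E] : Type _ := BandProj E → Prop

/-! ### Band projections and the representation on `BandSpace E`. -/

section BandProj

variable {E Y ι : Type*} [NormedAddCommGroup E] [NormedSpace ℝ E] [Lattice E]
  [MeasurableSpace Y] {ν : Measure Y} {idx : Y → ι} {p : ℝ≥0∞} [Fact (1 ≤ p)]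
  {Ψ : E ≃ₗᵢ[ℝ] Lp ℝ p ν}

/-- Every band projection is multiplication by the indicator function of a measurable set. -/
theorem BandProj.exists_set (h : IsDirectSum ν idx) (hΨ : IsLatticeIso Ψ) (P : BandProj E) :
    ∃ b, MeasurableSet b ∧ ∀ f, Ψ (P.1 f) =ᵐ[ν] b.indicator (Ψ f) := by
  set a : ι → E := fun i => Ψ.symm (h.unit p i) with ha
  have hΨa : ∀ i, Ψ (a i) = h.unit p i := fun i => Ψ.apply_symm_apply _
  refine ⟨{y | Ψ (P.1 (a (idx y))) y ≠ 0}, ?_, fun f => ?_⟩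
  · exact h.measurable_glue (F := fun i y => Ψ (P.1 (a i)) y) (fun i => measurable_coeFn _)
      (measurableSet_singleton (0 : ℝ)).compl
  · refine h.ae_of_fibres fun i => ?_
    -- On the fibre of `i` the function `a i` is 1. Where `P (a i)` vanishes, disjointness of `P f`
    -- from `a i - P (a i)` gives `P f = 0`; elsewhere, disjointness of `P (a i)` from `f - P f`
    -- gives `P f = f`.
    have h1 := latDisjoint_iff_ae.1 (hΨ.latDisjoint_iff.2 (P.2 f (a i)))
    have h2 := latDisjoint_iff_ae.1 (hΨ.latDisjoint_iff.2 (P.2 (a i) f))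
    rw [map_sub] at h1 h2
    filter_upwards [h1, h2, Lp.coeFn_sub (Ψ (a i)) (Ψ (P.1 (a i))),
      Lp.coeFn_sub (Ψ f) (Ψ (P.1 f)), h.unit_apply (p := p) i] with y h1 h2 h3 h4 h5
    rintro rfl
    rw [h3, Pi.sub_apply, hΨa, h5 rfl] at h1
    rw [h4, Pi.sub_apply] at h2
    by_cases h0 : Ψ (P.1 (a (idx y))) y = 0
    · rw [Set.indicator_of_notMem (by simpa using h0)]
      rw [h0, sub_zero] at h1
      exact h1.resolve_right one_ne_zero
    · rw [Set.indicator_of_mem (by exact h0)]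
      exact (sub_eq_zero.1 (h2.resolve_left h0)).symm

/-- Multiplication by an indicator function as a band projection. -/
noncomputable def BandProj.ofSet (hΨ : IsLatticeIso Ψ) {S : Set Y} (hS : MeasurableSet S) :
    BandProj E :=
  ⟨fun f => Ψ.symm (lpIndicator hS (Ψ f)), fun f g => by
    rw [← hΨ.latDisjoint_iff, latDisjoint_iff_ae, map_sub, Ψ.apply_symm_apply, Ψ.apply_symm_apply]
    filter_upwards [coeFn_lpIndicator hS (Ψ f), coeFn_lpIndicator hS (Ψ g),
      Lp.coeFn_sub (Ψ g) (lpIndicator hS (Ψ g))] with y h1 h2 h3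
    rw [h1, h3, Pi.sub_apply, h2]
    by_cases h : y ∈ S
    · right; rw [Set.indicator_of_mem h, sub_self]
    · left; rw [Set.indicator_of_notMem h]⟩

theorem BandProj.map_ofSet_apply (hΨ : IsLatticeIso Ψ) {S : Set Y} (hS : MeasurableSet S) (f : E) :
    Ψ ((BandProj.ofSet hΨ hS).1 f) = lpIndicator hS (Ψ f) :=
  Ψ.apply_symm_apply _

/-- The properties of the representation of `E` on `BandSpace E` that the action needs. -/
structure IsBandRep {μ : Measure (BandSpace E)} (Φ : E ≃ₗᵢ[ℝ] Lp ℝ p μ) (e : ι → E)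
    (c : ι → Set (BandSpace E)) : Prop where
  isLatticeIso : IsLatticeIso Φ
  coeFn_bandProj : ∀ (P : BandProj E) f, Φ (P.1 f) =ᵐ[μ] {z | z P}.indicator (Φ f)
  measurableSet : ∀ i, MeasurableSet (c i)
  measure_ne_top : ∀ i, μ (c i) ≠ ∞
  measure_eq_tsum : ∀ A, MeasurableSet A → μ A = ∑' i, μ (A ∩ c i)
  coeFn_unit : ∀ i, Φ (e i) =ᵐ[μ] (c i).indicator fun _ => 1
  exists_glue : ∀ f : ι → BandSpace E → ℝ≥0∞, (∀ j, Measurable (f j)) →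
    (Pairwise fun j k => ∀ᵐ z ∂μ, f j z = 0 ∨ f k z = 0) → (∀ j, ∀ᵐ z ∂μ, f j z ≠ ∞) →
    ∃ d : BandSpace E → ℝ≥0∞, Measurable d ∧ (∀ᵐ z ∂μ, d z ≠ ∞) ∧
      (∀ j, ∀ᵐ z ∂μ, f j z ≠ 0 → d z = f j z) ∧
      ∀ A, MeasurableSet A → ∫⁻ z in A, d z ∂μ = ∑' j, ∫⁻ z in A, f j z ∂μ

/-- Each `y` is sent to the indicator of the set of projections `P` with `y ∈ b P`, and `μ` is the
image measure. -/
theorem exists_isBandRep (h : IsDirectSum ν idx) (hΨ : IsLatticeIso Ψ) {e : ι → E}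
    (he : ∀ i, Ψ (e i) =ᵐ[ν] (idx ⁻¹' {i}).indicator fun _ => 1) :
    ∃ (μ : Measure (BandSpace E)) (Φ : E ≃ₗᵢ[ℝ] Lp ℝ p μ) (c : ι → Set (BandSpace E)),
      IsBandRep Φ e c := by
  choose b hb hbP using BandProj.exists_set h hΨ
  let ψ : Y → BandSpace E := fun y P => y ∈ b P
  have hψ : Measurable ψ := measurable_pi_iff.2 fun P => measurable_mem.2 (hb P)
  have hcm : ∀ P : BandProj E, MeasurableSet {z : BandSpace E | z P} := fun P =>
    measurableSet_setOfPred.2 (measurable_pi_apply P)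
  have hl : ∀ S, MeasurableSet S → ∃ C, MeasurableSet C ∧ ∀ᵐ y ∂ν, ψ y ∈ C ↔ y ∈ S := by
    intro S hS
    -- The coordinate of the projection "multiply by the indicator of `S`" recovers `S`, as testing
    -- on the units of the fibres shows.
    refine ⟨{z | z (BandProj.ofSet hΨ hS)}, hcm _, h.ae_of_fibres fun i => ?_⟩
    have h1 := hbP (BandProj.ofSet hΨ hS) (Ψ.symm (h.unit p i))
    rw [BandProj.map_ofSet_apply, Ψ.apply_symm_apply] at h1
    filter_upwards [h1, coeFn_lpIndicator hS (h.unit p i), h.unit_apply (p := p) i]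
      with y h1 h2 h3 hi
    rw [h2] at h1
    change y ∈ b _ ↔ _
    by_cases hy : y ∈ S <;> by_cases hy2 : y ∈ b (BandProj.ofSet hΨ hS)
    · simp [hy, hy2]
    · rw [Set.indicator_of_mem hy, h3 hi, Set.indicator_of_notMem hy2] at h1
      exact absurd h1 one_ne_zero
    · rw [Set.indicator_of_notMem hy, Set.indicator_of_mem hy2, h3 hi] at h1
      exact absurd h1 zero_ne_one
    · simp [hy, hy2]
  obtain ⟨μ, hμ⟩ : ∃ μ, μ = ν.map ψ := ⟨_, rfl⟩
  obtain ⟨Θ, hΘ, hΘc⟩ : ∃ Θ : Lp ℝ p μ ≃ₗᵢ[ℝ] Lp ℝ p ν, IsLatticeIso Θ ∧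
      ∀ f, Θ f =ᵐ[ν] fun y => f (ψ y) := hμ ▸ exists_latticeIso_map (p := p) hψ hl
  choose c hc hcs using fun i => hl _ (h.measurableSet_fibre i)
  have hmeas : ∀ A, MeasurableSet A → ∀ i, μ (A ∩ c i) = ν (ψ ⁻¹' A ∩ idx ⁻¹' {i}) := by
    intro A hA i
    rw [hμ, Measure.map_apply hψ (hA.inter (hc i))]
    refine measure_congr ?_
    filter_upwards [hcs i] with y hy
    exact propext (and_congr_right fun _ => hy)
  have hΦ : ∀ f, ∀ᵐ y ∂ν, Θ.symm (Ψ f) (ψ y) = Ψ f y := fun f => by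
    filter_upwards [hΘc (Θ.symm (Ψ f))] with y hy
    rw [← hy, Θ.apply_symm_apply]
  have hae : ∀ {P : BandSpace E → Prop}, MeasurableSet {z | P z} → (∀ᵐ y ∂ν, P (ψ y)) →
      ∀ᵐ z ∂μ, P z := fun hP h => by
    rw [hμ]
    exact (ae_map_iff hψ.aemeasurable hP).2 h
  refine ⟨μ, Ψ.trans Θ.symm, c, hΨ.trans hΘ.symm, fun P f => ?_, hc, fun i => ?_, fun A hA => ?_,
    fun i => ?_, fun f hf hfd hfin => ?_⟩
  · refine hae (measurableSet_eq_fun (measurable_coeFn _)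
      ((measurable_coeFn _).indicator (hcm P))) ?_
    filter_upwards [hΦ (P.1 f), hΦ f, hbP P f] with y h1 h2 h3
    simp only [LinearIsometryEquiv.trans_apply]
    rw [h1, h3]
    by_cases hy : y ∈ b P
    · rw [Set.indicator_of_mem hy, Set.indicator_of_mem (show ψ y ∈ {z | z P} from hy), h2]
    · rw [Set.indicator_of_notMem hy, Set.indicator_of_notMem (show ψ y ∉ {z | z P} from hy)]
  · have := hmeas Set.univ MeasurableSet.univ i
    rw [Set.univ_inter, Set.preimage_univ, Set.univ_inter] at this
    rw [this]
    exact h.measure_fibre_ne_top i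
  · simp only [hmeas A hA]
    rw [hμ, Measure.map_apply hψ hA]
    exact h.measure_eq_tsum _ (hψ hA)
  · refine hae (measurableSet_eq_fun (measurable_coeFn _)
      (measurable_const.indicator (hc i))) ?_
    filter_upwards [hΦ (e i), he i, hcs i] with y h1 h2 h3
    simp only [LinearIsometryEquiv.trans_apply]
    rw [h1, h2]
    by_cases hy : y ∈ idx ⁻¹' {i}
    · rw [Set.indicator_of_mem hy, Set.indicator_of_mem (h3.2 hy)]
    · rw [Set.indicator_of_notMem hy, Set.indicator_of_notMem (fun h => hy (h3.1 h))]
  -- The gluing takes place on `Y`, where measurability is tested on fibres; the result descends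
  -- along `ψ`.
  · have hmp : MeasurePreserving ψ ν μ := ⟨hψ, hμ.symm⟩
    obtain ⟨d', hd'm, hd'fin, hd'f, hd'i⟩ := h.exists_glue (f := fun j y => f j (ψ y))
      (fun j => (hf j).comp hψ) (fun j k hjk => hmp.quasiMeasurePreserving.ae (hfd hjk))
      (fun j => hmp.quasiMeasurePreserving.ae (hfin j))
    obtain ⟨d, hdm, hdd'⟩ := exists_measurable_comp_ae_eq hl hd'm
    refine ⟨d, hdm, ?_, fun j => ?_, fun A hA => ?_⟩
    · refine hae (hdm (measurableSet_singleton _).compl) ?_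
      filter_upwards [hd'fin, hdd'] with y h1 h2
      rwa [h2]
    · have hm : MeasurableSet {z | f j z ≠ 0 → d z = f j z} := by
        have : {z | f j z ≠ 0 → d z = f j z} = {z | f j z = 0} ∪ {z | d z = f j z} := by
          ext z; simp only [Set.mem_ofPred_eq, Set.mem_union]; tauto
        rw [this]
        exact (hf j (measurableSet_singleton _)).union (measurableSet_eq_fun hdm (hf j))
      refine hae hm ?_
      filter_upwards [hd'f j, hdd'] with y h1 h2
      rwa [h2]
    · rw [hμ, setLIntegral_map hA hdm hψ]
      rw [show ∫⁻ y in ψ ⁻¹' A, d (ψ y) ∂ν = ∫⁻ y in ψ ⁻¹' A, d' y ∂ν from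
        lintegral_congr_ae (ae_restrict_of_ae hdd'), hd'i _ (hψ hA)]
      exact tsum_congr fun j => (setLIntegral_map hA (hf j) hψ).symm

end BandProj

theorem indicator_ae_eq_zero {Z : Type*} [MeasurableSpace Z] {μ : Measure Z} {A : Set Z}
    (h0 : μ A = 0) (g : Z → ℝ) : A.indicator g =ᵐ[μ] 0 := by
  filter_upwards [measure_eq_zero_iff_ae_notMem.1 h0] with z hz
  exact Set.indicator_of_notMem hz _

/-! ### The action on points by conjugating band projections. -/

section BandAction

variable {E : Type*} [NormedAddCommGroup E] [NormedSpace ℝ E] [Lattice E]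

/-- Lattice automorphisms act on band projections by conjugation. -/
def BandProj.conj (T : LatticeAut E) (P : BandProj E) : BandProj E :=
  ⟨fun f => (T : E ≃ₗᵢ[ℝ] E) (P.1 ((T : E ≃ₗᵢ[ℝ] E).symm f)), fun f g => by
    have hT : IsLatticeIso (T : E ≃ₗᵢ[ℝ] E) := T.2
    have h := hT.latDisjoint_iff.2
      (P.2 ((T : E ≃ₗᵢ[ℝ] E).symm f) ((T : E ≃ₗᵢ[ℝ] E).symm g))
    rwa [map_sub, LinearIsometryEquiv.apply_symm_apply] at h⟩

theorem BandProj.conj_one (P : BandProj E) : BandProj.conj 1 P = P := rfl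

/-- This law is exact, not merely almost everywhere, so permuting coordinates gives a genuine action
on points. -/
theorem BandProj.conj_mul (S T : LatticeAut E) (P : BandProj E) :
    BandProj.conj (S * T) P = BandProj.conj S (BandProj.conj T P) := rfl

/-- The action of lattice automorphisms on `BandSpace E` by permutation of coordinates. -/
def bandPerm : LatticeAut E →* Equiv.Perm (BandSpace E) where
  toFun T :=
    -- With the inverse this is a left action, and the preimage of the coordinate set of `P` is the
    -- coordinate set of `T⁻¹ P T`.
    { toFun := fun z P => z (BandProj.conj T⁻¹ P)
      invFun := fun z P => z (BandProj.conj T P)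
      left_inv := fun z => by
        funext P
        change z (BandProj.conj T⁻¹ (BandProj.conj T P)) = z P
        rw [← BandProj.conj_mul, inv_mul_cancel, BandProj.conj_one]
      right_inv := fun z => by
        funext P
        change z (BandProj.conj T (BandProj.conj T⁻¹ P)) = z P
        rw [← BandProj.conj_mul, mul_inv_cancel, BandProj.conj_one] }
  map_one' := by
    ext z P
    change z (BandProj.conj 1⁻¹ P) ↔ z P
    rw [inv_one, BandProj.conj_one]
  map_mul' S T := by
    ext z P
    change z (BandProj.conj (S * T)⁻¹ P) ↔ z (BandProj.conj T⁻¹ (BandProj.conj S⁻¹ P))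
    rw [mul_inv_rev, BandProj.conj_mul]

theorem measurable_bandPerm (T : LatticeAut E) : Measurable (bandPerm T) :=
  measurable_pi_iff.2 fun _ => measurable_pi_apply _

theorem measurable_bandPerm_symm (T : LatticeAut E) : Measurable (bandPerm T).symm :=
  measurable_pi_iff.2 fun _ => measurable_pi_apply _

end BandAction

/-! ### Non-singularity of the action and its Radon-Nikodym derivatives. -/

section BandRep

variable {E ι : Type*} [NormedAddCommGroup E] [NormedSpace ℝ E] [Lattice E]
  {p : ℝ≥0∞} [Fact (1 ≤ p)] {μ : Measure (BandSpace E)} {Φ : E ≃ₗᵢ[ℝ] Lp ℝ p μ} {e : ι → E}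
  {c : ι → Set (BandSpace E)}

theorem exists_indicator (Φ : E ≃ₗᵢ[ℝ] Lp ℝ p μ) {A : Set (BandSpace E)} (hA : MeasurableSet A)
    (g : E) : ∃ f, Φ f =ᵐ[μ] A.indicator (Φ g) :=
  ⟨Φ.symm (lpIndicator hA (Φ g)), by rw [Φ.apply_symm_apply]; exact coeFn_lpIndicator hA _⟩

theorem eq_zero_of_ae (Φ : E ≃ₗᵢ[ℝ] Lp ℝ p μ) {f : E} (h : Φ f =ᵐ[μ] 0) : f = 0 :=
  (map_eq_zero_iff Φ Φ.injective).1 (Lp.eq_zero_iff_ae_eq_zero.2 h)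

theorem coeFn_map_zero (Φ : E ≃ₗᵢ[ℝ] Lp ℝ p μ) : Φ 0 =ᵐ[μ] 0 := by
  rw [map_zero]
  exact Lp.coeFn_zero ℝ p μ

theorem coeFn_map_sub (Φ : E ≃ₗᵢ[ℝ] Lp ℝ p μ) (f g : E) :
    ∀ᵐ z ∂μ, Φ (f - g) z = Φ f z - Φ g z := by
  rw [map_sub]
  exact Lp.coeFn_sub _ _

namespace IsBandRep

/-- A lattice automorphism carries multiplication by the indicator function of the preimage of a set
to multiplication by the indicator function of that set. -/
theorem map_indicator (h : IsBandRep Φ e c) (T : LatticeAut E) {A : Set (BandSpace E)}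
    (hA : MeasurableSet A) {f g : E} (hfg : Φ f =ᵐ[μ] (bandPerm T ⁻¹' A).indicator (Φ g)) :
    Φ ((T : E ≃ₗᵢ[ℝ] E) f) =ᵐ[μ] A.indicator (Φ ((T : E ≃ₗᵢ[ℝ] E) g)) := by
  set t : E ≃ₗᵢ[ℝ] E := (T : E ≃ₗᵢ[ℝ] E) with ht
  have hT : IsLatticeIso t := T.2
  have hcoord : ∀ P : BandProj E, MeasurableSet {z : BandSpace E | z P} := fun P =>
    measurableSet_setOfPred.2 (measurable_pi_apply P)
  -- The sets `A` with the asserted property form a σ-algebra, so it is enough to treat coordinate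
  -- sets.
  let m : MeasurableSpace (BandSpace E) :=
    { MeasurableSet' := fun A => MeasurableSet A ∧
        ∀ f g, Φ f =ᵐ[μ] (bandPerm T ⁻¹' A).indicator (Φ g) →
          Φ (t f) =ᵐ[μ] A.indicator (Φ (t g))
      measurableSet_empty := by
        refine ⟨MeasurableSet.empty, fun f g hfg => ?_⟩
        rw [Set.preimage_empty, Set.indicator_empty] at hfg
        rw [eq_zero_of_ae Φ hfg, map_zero, Set.indicator_empty]
        exact coeFn_map_zero Φ
      measurableSet_compl := by
        rintro A ⟨hA, hT⟩
        refine ⟨hA.compl, fun f g hfg => ?_⟩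
        have h1 := hT (g - f) g (by
          filter_upwards [hfg, coeFn_map_sub Φ g f] with z h1 h2
          rw [h2, h1, Set.preimage_compl, Set.indicator_compl, Pi.sub_apply, sub_sub_cancel])
        rw [map_sub] at h1
        filter_upwards [h1, coeFn_map_sub Φ (t g) (t f)] with z h1 h2
        rw [Set.indicator_compl, Pi.sub_apply, ← h1, h2, sub_sub_cancel]
      measurableSet_iUnion := by
        intro A hA
        have hUm : MeasurableSet (⋃ n, A n) := MeasurableSet.iUnion fun n => (hA n).1
        refine ⟨hUm, fun f g hfg => ?_⟩
        -- `f` and `g` have the same truncation to the preimage of `A n`.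
        have hon : ∀ᵐ z ∂μ, ∀ n, z ∈ A n → Φ (t f) z = Φ (t g) z := by
          refine ae_all_iff.2 fun n => ?_
          obtain ⟨k, hk⟩ := exists_indicator Φ (measurable_bandPerm T (hA n).1) g
          have h1 := (hA n).2 k g hk
          have h2 := (hA n).2 k f (by
            filter_upwards [hk, hfg] with z h1 h2
            rw [h1]
            by_cases hz : z ∈ bandPerm T ⁻¹' A n
            · rw [Set.indicator_of_mem hz, Set.indicator_of_mem hz, h2,
                Set.indicator_of_mem (show z ∈ bandPerm T ⁻¹' ⋃ n, A n from
                  Set.mem_iUnion_of_mem n hz)]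
            · rw [Set.indicator_of_notMem hz, Set.indicator_of_notMem hz])
          filter_upwards [h1, h2] with z h1 h2 hz
          rw [h1, Set.indicator_of_mem hz, Set.indicator_of_mem hz] at h2
          exact h2.symm
        -- Let `w` be the part of `T f` off the union. Then `T⁻¹ w` vanishes on the preimage of
        -- every `A n`, whereas `f` lives on their union. So `w` is disjoint from `T f`, which
        -- forces `T f = 0` off the union.
        obtain ⟨w, hw⟩ := exists_indicator Φ hUm.compl (t f)
        have hv : ∀ᵐ z ∂μ, ∀ n, z ∈ bandPerm T ⁻¹' A n → Φ (t.symm w) z = 0 := by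
          refine ae_all_iff.2 fun n => ?_
          obtain ⟨k, hk⟩ := exists_indicator Φ (measurable_bandPerm T (hA n).1) (t.symm w)
          have h1 := (hA n).2 k _ hk
          rw [t.apply_symm_apply] at h1
          have hk0 : k = 0 := by
            refine (map_eq_zero_iff t t.injective).1 (eq_zero_of_ae Φ ?_)
            filter_upwards [h1, hw] with z h1 h2
            rw [h1]
            by_cases hz : z ∈ A n
            · rw [Set.indicator_of_mem hz, h2, Set.indicator_of_notMem
                (show z ∉ (⋃ n, A n)ᶜ from fun hc => hc (Set.mem_iUnion_of_mem n hz))]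
              rfl
            · rw [Set.indicator_of_notMem hz]
              rfl
          subst hk0
          filter_upwards [hk, coeFn_map_zero Φ] with z h1 h2 hz
          rw [h2, Set.indicator_of_mem hz] at h1
          exact h1.symm
        have hdisj : LatDisjoint (t f) w := by
          rw [← t.apply_symm_apply w, hT.latDisjoint_iff, ← h.isLatticeIso.latDisjoint_iff,
            latDisjoint_iff_ae]
          filter_upwards [hv, hfg] with z h1 h2
          by_cases hz : z ∈ bandPerm T ⁻¹' ⋃ n, A n
          · right
            obtain ⟨n, hn⟩ := Set.mem_iUnion.1 hz
            exact h1 n hn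
          · left
            rw [h2, Set.indicator_of_notMem hz]
        filter_upwards [hon, hw, latDisjoint_iff_ae.1 (h.isLatticeIso.latDisjoint_iff.2 hdisj)]
          with z h1 h2 h3
        by_cases hz : z ∈ ⋃ n, A n
        · rw [Set.indicator_of_mem hz]
          obtain ⟨n, hn⟩ := Set.mem_iUnion.1 hz
          exact h1 n hn
        · rw [Set.indicator_of_notMem hz]
          rw [h2, Set.indicator_of_mem hz] at h3
          exact h3.elim id id }
  have hle : (MeasurableSpace.pi : MeasurableSpace (BandSpace E)) ≤ m := by
    refine iSup_le fun P => Measurable.comap_le (@measurable_to_prop _ m _ ?_)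
    have hP : (fun z : BandSpace E => z P) ⁻¹' {True} = {z | z P} := by
      ext z; simp
    rw [hP]
    -- For a coordinate set the claim is the identity `T (T⁻¹ P T) g = P (T g)`.
    refine ⟨hcoord P, fun f g hfg => ?_⟩
    have h1 : Φ f = Φ ((BandProj.conj T⁻¹ P).1 g) :=
      Lp.ext (hfg.trans (h.coeFn_bandProj (BandProj.conj T⁻¹ P) g).symm)
    have h2 : t f = P.1 (t g) := by
      rw [Φ.injective h1]
      exact t.apply_symm_apply _
    rw [h2]
    exact h.coeFn_bandProj P _
  exact (hle A hA).2 f g hfg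

theorem measure_eq_zero_of (h : IsBandRep Φ e c) {A : Set (BandSpace E)} (hA : MeasurableSet A)
    (h0 : ∀ g, A.indicator (Φ g) =ᵐ[μ] 0) : μ A = 0 := by
  rw [h.measure_eq_tsum A hA, ENNReal.tsum_eq_zero]
  intro i
  refine measure_mono_null ?_ (ae_iff.1 ((h0 (e i)).and (h.coeFn_unit i)))
  rintro z ⟨hz1, hz2⟩ ⟨h1, h2⟩
  rw [Set.indicator_of_mem hz1, h2, Set.indicator_of_mem hz2] at h1
  exact one_ne_zero h1

/-- A set is null exactly when multiplication by its indicator is zero, and `T` intertwines these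
multiplications for `A` and its preimage. -/
theorem measure_preimage_eq_zero_iff (h : IsBandRep Φ e c) (T : LatticeAut E)
    {A : Set (BandSpace E)} (hA : MeasurableSet A) : μ (bandPerm T ⁻¹' A) = 0 ↔ μ A = 0 := by
  constructor
  · refine fun h0 => h.measure_eq_zero_of hA fun g => ?_
    have := h.map_indicator T hA (f := 0) (g := (T : E ≃ₗᵢ[ℝ] E).symm g)
      ((coeFn_map_zero Φ).trans (indicator_ae_eq_zero h0 _).symm)
    rw [map_zero, LinearIsometryEquiv.apply_symm_apply] at this
    exact this.symm.trans (coeFn_map_zero Φ)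
  · refine fun h0 => h.measure_eq_zero_of (measurable_bandPerm T hA) fun g => ?_
    obtain ⟨f, hf⟩ := exists_indicator Φ (measurable_bandPerm T hA) g
    have h1 := (h.map_indicator T hA hf).trans (indicator_ae_eq_zero h0 _)
    have h2 := (map_eq_zero_iff _ (T : E ≃ₗᵢ[ℝ] E).injective).1 (eq_zero_of_ae Φ h1)
    rw [h2] at hf
    exact hf.symm.trans (coeFn_map_zero Φ)

theorem isSemifinite (h : IsBandRep Φ e c) : IsSemifinite μ := by
  intro A hA hinf
  have : ∃ i, μ (A ∩ c i) ≠ 0 := by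
    by_contra! h0
    rw [h.measure_eq_tsum A hA, ENNReal.tsum_eq_zero.2 h0] at hinf
    exact ENNReal.zero_ne_top hinf
  obtain ⟨i, hi⟩ := this
  exact ⟨A ∩ c i, hA.inter (h.measurableSet i), Set.inter_subset_left, pos_iff_ne_zero.2 hi,
    (measure_mono Set.inter_subset_right).trans_lt (h.measure_ne_top i).lt_top⟩

/-- Null sets may be pulled back by the permutation and then tested on each `c j`, so the images of
the `c j` suffice. -/
theorem ae_of_forall_preimage (h : IsBandRep Φ e c) (T : LatticeAut E) {P : BandSpace E → Prop}
    (hP : MeasurableSet {z | P z})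
    (hPc : ∀ j, ∀ᵐ z ∂μ, (bandPerm T).symm z ∈ c j → P z) : ∀ᵐ z ∂μ, P z := by
  have hm : MeasurableSet {z | ¬P z} := hP.compl
  rw [ae_iff, ← h.measure_preimage_eq_zero_iff T hm,
    h.measure_eq_tsum _ (measurable_bandPerm T hm), ENNReal.tsum_eq_zero]
  intro j
  have hm2 : MeasurableSet ({z | ¬P z} ∩ (bandPerm T).symm ⁻¹' c j) :=
    hm.inter (measurable_bandPerm_symm T (h.measurableSet j))
  have h0 : μ ({z | ¬P z} ∩ (bandPerm T).symm ⁻¹' c j) = 0 := by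
    refine measure_mono_null ?_ (ae_iff.1 (hPc j))
    rintro z ⟨h1, h2⟩ h3
    exact h1 (h3 h2)
  rw [← h.measure_preimage_eq_zero_iff T hm2] at h0
  convert h0 using 2
  ext z
  simp

/-- Truncating `w` to the preimage of `A` gives a positive element, which `T` sends to a positive
one agreeing with `T w` on `A`. -/
theorem ae_nonneg_map (h : IsBandRep Φ e c) (T : LatticeAut E) {A : Set (BandSpace E)}
    (hA : MeasurableSet A) {w : E} (hw : ∀ᵐ z ∂μ, bandPerm T z ∈ A → 0 ≤ Φ w z) :
    ∀ᵐ z ∂μ, z ∈ A → 0 ≤ Φ ((T : E ≃ₗᵢ[ℝ] E) w) z := by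
  have hT : IsLatticeIso (T : E ≃ₗᵢ[ℝ] E) := T.2
  obtain ⟨k, hk⟩ := exists_indicator Φ (measurable_bandPerm T hA) w
  have hk0 : 0 ≤ Φ ((T : E ≃ₗᵢ[ℝ] E) k) := by
    rw [h.isLatticeIso.nonneg_iff, hT.nonneg_iff, ← h.isLatticeIso.nonneg_iff, ← Lp.coeFn_nonneg]
    filter_upwards [hk, hw] with z h1 h2
    rw [h1]
    exact Set.indicator_apply_nonneg h2
  filter_upwards [h.map_indicator T hA hk, (Lp.coeFn_nonneg _).2 hk0] with z h1 h2 hz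
  rw [h1, Set.indicator_of_mem hz] at h2
  exact h2

end IsBandRep

theorem eq_mul_of_forall_rat {a b t : ℝ} (h1 : ∀ q : ℚ, (q : ℝ) < t → q * b ≤ a)
    (h2 : ∀ q : ℚ, t < q → a ≤ q * b) : a = b * t := by
  refine le_antisymm ?_ ?_
  · refine le_of_forall_pos_le_add fun δ hδ => ?_
    -- The summand 1 covers `b = 0`; no sign of `b` is assumed.
    have hb : 0 < |b| + 1 := by positivity
    obtain ⟨q, hq1, hq2⟩ := exists_rat_btwn (lt_add_of_pos_right t (div_pos hδ hb))
    have h3 := h2 q hq1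
    have h4 : (q - t) * (|b| + 1) < δ := by rw [← lt_div_iff₀ hb]; linarith
    nlinarith [le_abs_self b, mul_le_mul_of_nonneg_left (le_abs_self b) (sub_pos.2 hq1).le]
  · refine le_of_forall_pos_le_add fun δ hδ => ?_
    have hb : 0 < |b| + 1 := by positivity
    obtain ⟨q, hq1, hq2⟩ := exists_rat_btwn (sub_lt_self t (div_pos hδ hb))
    have h3 := h1 q hq2
    have h4 : (t - q) * (|b| + 1) < δ := by rw [← lt_div_iff₀ hb]; linarith
    nlinarith [le_abs_self b, mul_le_mul_of_nonneg_left (le_abs_self b) (sub_pos.2 hq2).le]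

namespace IsBandRep

/-- On the image of the support of the unit `e j`, a lattice automorphism is composition with the
inverse transformation, multiplied by the image of `e j`. -/
theorem coeFn_map_eq_mul (h : IsBandRep Φ e c) (T : LatticeAut E) (j : ι) (f : E) :
    ∀ᵐ z ∂μ, (bandPerm T).symm z ∈ c j → Φ ((T : E ≃ₗᵢ[ℝ] E) f) z =
      Φ ((T : E ≃ₗᵢ[ℝ] E) (e j)) z * Φ f ((bandPerm T).symm z) := by
  have hfm := measurable_coeFn (Φ f)
  have hsub : ∀ (g k : E) (q : ℝ), ∀ᵐ z ∂μ, Φ (g - q • k) z = Φ g z - q * Φ k z := fun g k q => by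
    filter_upwards [coeFn_map_sub Φ g (q • k), Lp.coeFn_smul q (Φ k)] with z h1 h2
    rw [h1, map_smul, h2, Pi.smul_apply, smul_eq_mul]
  -- Where `f > q` within `c j`, the element `f - q e j` is positive, and positivity passes to the
  -- image. Rational `q` keep the exceptional sets countable in number.
  have hlow : ∀ q : ℚ, ∀ᵐ z ∂μ, (bandPerm T).symm z ∈ c j → (q : ℝ) < Φ f ((bandPerm T).symm z) →
      q * Φ ((T : E ≃ₗᵢ[ℝ] E) (e j)) z ≤ Φ ((T : E ≃ₗᵢ[ℝ] E) f) z := fun q => by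
    have hB : MeasurableSet (c j ∩ {z | (q : ℝ) < Φ f z}) :=
      (h.measurableSet j).inter (measurableSet_lt measurable_const hfm)
    have h1 := h.ae_nonneg_map T (measurable_bandPerm_symm T hB) (w := f - (q : ℝ) • e j) (by
      filter_upwards [hsub f (e j) q, h.coeFn_unit j] with z h1 h2 hz
      rw [Set.mem_preimage, Equiv.symm_apply_apply] at hz
      rw [h1, h2, Set.indicator_of_mem hz.1, mul_one]
      exact sub_nonneg.2 (le_of_lt hz.2))
    rw [map_sub, map_smul] at h1
    filter_upwards [h1, hsub ((T : E ≃ₗᵢ[ℝ] E) f) ((T : E ≃ₗᵢ[ℝ] E) (e j)) q] with z h1 h2 hz hq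
    have := h1 ⟨hz, hq⟩
    rwa [h2, sub_nonneg] at this
  have hupp : ∀ q : ℚ, ∀ᵐ z ∂μ, (bandPerm T).symm z ∈ c j → Φ f ((bandPerm T).symm z) < q →
      Φ ((T : E ≃ₗᵢ[ℝ] E) f) z ≤ q * Φ ((T : E ≃ₗᵢ[ℝ] E) (e j)) z := fun q => by
    have hB : MeasurableSet (c j ∩ {z | Φ f z < (q : ℝ)}) :=
      (h.measurableSet j).inter (measurableSet_lt hfm measurable_const)
    have h1 := h.ae_nonneg_map T (measurable_bandPerm_symm T hB) (w := (q : ℝ) • e j - f) (by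
      filter_upwards [hsub f (e j) q, coeFn_map_sub Φ ((q : ℝ) • e j) f,
        coeFn_map_sub Φ f ((q : ℝ) • e j), h.coeFn_unit j] with z h1 h2 h3 h4 hz
      rw [Set.mem_preimage, Equiv.symm_apply_apply] at hz
      rw [h4, Set.indicator_of_mem hz.1, mul_one] at h1
      have : Φ f z < q := hz.2
      linarith)
    rw [map_sub, map_smul] at h1
    filter_upwards [h1, hsub ((T : E ≃ₗᵢ[ℝ] E) f) ((T : E ≃ₗᵢ[ℝ] E) (e j)) q,
      coeFn_map_sub Φ ((q : ℝ) • (T : E ≃ₗᵢ[ℝ] E) (e j)) ((T : E ≃ₗᵢ[ℝ] E) f),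
      coeFn_map_sub Φ ((T : E ≃ₗᵢ[ℝ] E) f) ((q : ℝ) • (T : E ≃ₗᵢ[ℝ] E) (e j))]
      with z h1 h2 h3 h4 hz hq
    have := h1 ⟨hz, hq⟩
    linarith
  filter_upwards [ae_all_iff.2 hlow, ae_all_iff.2 hupp] with z h1 h2 hz
  exact eq_mul_of_forall_rat (fun q => h1 q hz) fun q => h2 q hz

/-- Where `T (e j)` vanishes on the image of `c j`, the corresponding truncation of `e j` is killed
by `T`, hence zero by injectivity; so this set is null. -/
theorem coeFn_map_unit_pos (h : IsBandRep Φ e c) (T : LatticeAut E) (j : ι) :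
    ∀ᵐ z ∂μ, (bandPerm T).symm z ∈ c j → 0 < Φ ((T : E ≃ₗᵢ[ℝ] E) (e j)) z := by
  have hA : MeasurableSet ((bandPerm T).symm ⁻¹' c j ∩ {z | Φ ((T : E ≃ₗᵢ[ℝ] E) (e j)) z = 0}) :=
    (measurable_bandPerm_symm T (h.measurableSet j)).inter
      (measurable_coeFn _ (measurableSet_singleton (0 : ℝ)))
  obtain ⟨f, hf⟩ := exists_indicator Φ (measurable_bandPerm T hA) (e j)
  have hf0 : f = 0 := by
    refine (map_eq_zero_iff _ (T : E ≃ₗᵢ[ℝ] E).injective).1 (eq_zero_of_ae Φ ?_)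
    filter_upwards [h.map_indicator T hA hf] with z hz
    rw [hz]
    exact Set.indicator_apply_eq_zero.2 fun h => h.2
  subst hf0
  have hnull : μ (bandPerm T ⁻¹' ((bandPerm T).symm ⁻¹' c j ∩
      {z | Φ ((T : E ≃ₗᵢ[ℝ] E) (e j)) z = 0})) = 0 := by
    refine measure_mono_null ?_ (ae_iff.1 (hf.and ((coeFn_map_zero Φ).and (h.coeFn_unit j))))
    rintro z hz ⟨h1, h2, h3⟩
    have hzc : z ∈ c j := by simpa using hz.1
    rw [Set.indicator_of_mem hz, h2, h3, Set.indicator_of_mem hzc] at h1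
    exact zero_ne_one h1
  rw [h.measure_preimage_eq_zero_iff T hA] at hnull
  have hnn := h.ae_nonneg_map T (w := e j) (MeasurableSet.univ) (by
    filter_upwards [h.coeFn_unit j] with z hz _
    rw [hz]
    exact Set.indicator_apply_nonneg fun _ => zero_le_one)
  filter_upwards [measure_eq_zero_iff_ae_notMem.1 hnull, hnn] with z h1 h2 hz
  exact lt_of_le_of_ne (h2 trivial) fun h3 => h1 ⟨hz, h3.symm⟩

/-- The two sides are the `p`-th powers of the norms of `T f` and `f`, where `f` is `e j` truncated
to the preimage of `A`. -/
theorem setLIntegral_map_unit (hp : p ≠ ∞) (h : IsBandRep Φ e c) (T : LatticeAut E)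
    {A : Set (BandSpace E)} (hA : MeasurableSet A) (j : ι) :
    ∫⁻ z in A, ‖Φ ((T : E ≃ₗᵢ[ℝ] E) (e j)) z‖ₑ ^ p.toReal ∂μ = μ (bandPerm T ⁻¹' A ∩ c j) := by
  have hp0 := toReal_pos_of_fact hp
  have hA' := measurable_bandPerm T hA
  obtain ⟨f, hf⟩ := exists_indicator Φ hA' (e j)
  have h1 : ‖Φ ((T : E ≃ₗᵢ[ℝ] E) f)‖ₑ = ‖Φ f‖ₑ := by
    rw [LinearIsometryEquiv.enorm_map, LinearIsometryEquiv.enorm_map,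
      LinearIsometryEquiv.enorm_map]
  have h2 := congrArg (· ^ p.toReal) h1
  simp only [enorm_rpow_toReal hp] at h2
  have hind : ∀ (B : Set (BandSpace E)) (g : BandSpace E → ℝ) z,
      ‖B.indicator g z‖ₑ ^ p.toReal = B.indicator (fun z => ‖g z‖ₑ ^ p.toReal) z := fun B g z => by
    by_cases hz : z ∈ B
    · rw [Set.indicator_of_mem hz, Set.indicator_of_mem hz]
    · rw [Set.indicator_of_notMem hz, Set.indicator_of_notMem hz, enorm_zero,
        ENNReal.zero_rpow_of_pos hp0]
  have h3 : ∫⁻ z, ‖Φ ((T : E ≃ₗᵢ[ℝ] E) f) z‖ₑ ^ p.toReal ∂μ =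
      ∫⁻ z in A, ‖Φ ((T : E ≃ₗᵢ[ℝ] E) (e j)) z‖ₑ ^ p.toReal ∂μ := by
    rw [← lintegral_indicator hA]
    refine lintegral_congr_ae ?_
    filter_upwards [h.map_indicator T hA hf] with z hz
    rw [hz, hind]
  rw [← h3, h2, ← lintegral_indicator_one (hA'.inter (h.measurableSet j))]
  refine lintegral_congr_ae ?_
  filter_upwards [hf, h.coeFn_unit j] with z h1 h2
  rw [h1]
  by_cases hz : z ∈ bandPerm T ⁻¹' A
  · by_cases hz2 : z ∈ c j
    · rw [Set.indicator_of_mem hz, h2, Set.indicator_of_mem hz2,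
        Set.indicator_of_mem (show z ∈ bandPerm T ⁻¹' A ∩ c j from ⟨hz, hz2⟩)]
      simp
    · rw [Set.indicator_of_mem hz, h2, Set.indicator_of_notMem hz2,
        Set.indicator_of_notMem fun h => hz2 h.2, enorm_zero, ENNReal.zero_rpow_of_pos hp0]
  · rw [Set.indicator_of_notMem hz, Set.indicator_of_notMem fun h => hz h.1, enorm_zero,
      ENNReal.zero_rpow_of_pos hp0]

/-- The functions `|T (e j)| ^ p` are disjoint because `T` preserves disjointness. Glued together
they have the right integrals, by summing `setLIntegral_map_unit` over `j`. -/
theorem exists_density (hp : p ≠ ∞) (h : IsBandRep Φ e c)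
    (hd : Pairwise fun i j => LatDisjoint (e i) (e j)) (T : LatticeAut E) :
    ∃ D : BandSpace E → ℝ≥0, Measurable D ∧
      (∀ A, MeasurableSet A → μ (bandPerm T ⁻¹' A) = ∫⁻ z in A, (D z : ℝ≥0∞) ∂μ) ∧
      ∀ f : E, ∀ᵐ z ∂μ, Φ ((T : E ≃ₗᵢ[ℝ] E) f) z =
        (D z : ℝ) ^ (1 / p.toReal) * Φ f ((bandPerm T).symm z) := by
  have hp0 := toReal_pos_of_fact hp
  have hT : IsLatticeIso (T : E ≃ₗᵢ[ℝ] E) := T.2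
  obtain ⟨d, hdm, hdfin, hdf, hdi⟩ := h.exists_glue
    (fun j z => ‖Φ ((T : E ≃ₗᵢ[ℝ] E) (e j)) z‖ₑ ^ p.toReal)
    (fun j => (measurable_coeFn _).enorm.pow_const _)
    (fun i j hij => by
      filter_upwards [latDisjoint_iff_ae.1 (h.isLatticeIso.latDisjoint_iff.2
        (hT.latDisjoint_iff.2 (hd hij)))] with z hz
      simpa [hp0, hp0.le, hp0.not_gt] using hz)
    (fun j => Filter.Eventually.of_forall fun z =>
      ENNReal.rpow_ne_top_of_nonneg hp0.le enorm_ne_top)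
  refine ⟨fun z => (d z).toNNReal, hdm.ennreal_toNNReal, fun A hA => ?_, fun f => ?_⟩
  · have h1 : ∫⁻ z in A, ((d z).toNNReal : ℝ≥0∞) ∂μ = ∫⁻ z in A, d z ∂μ := by
      refine lintegral_congr_ae (ae_restrict_of_ae ?_)
      filter_upwards [hdfin] with z hz using ENNReal.coe_toNNReal hz
    rw [h1, hdi A hA, h.measure_eq_tsum _ (measurable_bandPerm T hA)]
    exact tsum_congr fun j => (setLIntegral_map_unit hp h T hA j).symm
  · have hm : Measurable fun z => (((d z).toNNReal : ℝ≥0) : ℝ) ^ (1 / p.toReal) *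
        Φ f ((bandPerm T).symm z) :=
      (hdm.ennreal_toNNReal.coe_nnreal_real.pow_const _).mul
        ((measurable_coeFn (Φ f)).comp (measurable_bandPerm_symm T))
    refine h.ae_of_forall_preimage T (measurableSet_eq_fun (measurable_coeFn _) hm) fun j => ?_
    -- On the image of `c j` the glued density is `|T (e j)| ^ p`, and positivity of `T (e j)` makes
    -- its `p`-th root equal to `T (e j)`.
    filter_upwards [h.coeFn_map_eq_mul T j f, h.coeFn_map_unit_pos T j, hdf j] with z h1 h2 h3 hz
    have h4 := h2 hz
    rw [h1 hz, h3 ((weight_ne_zero_iff hp0).2 h4.ne')]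
    congr 1
    rw [ENNReal.coe_toNNReal_eq_toReal, ← ENNReal.toReal_rpow, toReal_enorm,
      ← Real.rpow_mul (norm_nonneg _),
      mul_one_div_cancel hp0.ne', Real.rpow_one, Real.norm_of_nonneg h4.le]

/-- The action on `BandSpace E` as an action by non-singular transformations. -/
def nonsingularHom (h : IsBandRep Φ e c) : LatticeAut E →* NonsingularAut μ :=
  bandPerm.codRestrict _ fun T => ⟨measurable_bandPerm T, measurable_bandPerm_symm T,
    fun _ hA => h.measure_preimage_eq_zero_iff T hA⟩

end IsBandRep

/-- Lattice automorphisms can be transported along a lattice isomorphism. -/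
def latticeAutCongr {F : Type*} [NormedAddCommGroup F] [NormedSpace ℝ F] [Lattice F]
    {Φ : E ≃ₗᵢ[ℝ] F} (hΦ : IsLatticeIso Φ) : LatticeAut E →* LatticeAut F where
  toFun T := ⟨(Φ.symm.trans (T : E ≃ₗᵢ[ℝ] E)).trans Φ,
    (hΦ.symm.trans (show IsLatticeIso (T : E ≃ₗᵢ[ℝ] E) from T.2)).trans hΦ⟩
  map_one' := by
    ext x
    exact Φ.apply_symm_apply x
  map_mul' S T := by
    ext x
    change Φ ((S : E ≃ₗᵢ[ℝ] E) ((T : E ≃ₗᵢ[ℝ] E) (Φ.symm x))) =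
      Φ ((S : E ≃ₗᵢ[ℝ] E) (Φ.symm (Φ ((T : E ≃ₗᵢ[ℝ] E) (Φ.symm x)))))
    rw [Φ.symm_apply_apply]

theorem IsBandRep.exists_isConcreteAction (hp : p ≠ ∞) (h : IsBandRep Φ e c)
    (hd : Pairwise fun i j => LatDisjoint (e i) (e j)) {G : Type*} [Group G]
    (ρ : G →* LatticeAut E) :
    ∃ (π : G →* NonsingularAut μ) (τ : G →* LatticeAut (Lp ℝ p μ)),
      IsConcreteAction π τ ∧ IsGLatticeIso ρ τ Φ := by
  refine ⟨h.nonsingularHom.comp ρ, (latticeAutCongr h.isLatticeIso).comp ρ,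
    ⟨h.isSemifinite, fun g => ?_⟩, h.isLatticeIso, fun g x => ?_⟩
  · obtain ⟨D, hDm, hDi, hDf⟩ := h.exists_density hp hd (ρ g)
    refine ⟨D, hDm, hDi, fun f => ?_⟩
    have := hDf (Φ.symm f)
    rw [Φ.apply_symm_apply] at this
    exact this
  · change _ = Φ (((ρ g : LatticeAut E) : E ≃ₗᵢ[ℝ] E) (Φ.symm (Φ x)))
    rw [Φ.symm_apply_apply]

end BandRep

/-! ### Assembly, and the case of a weak unit. -/

theorem exists_concrete_of_maximal {p : ℝ≥0∞} [Fact (1 ≤ p)] (hp : p ≠ ∞)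
    {G : Type w} [Group G]
    {E : Type u} [NormedAddCommGroup E] [NormedSpace ℝ E] [Lattice E]
    (hE : IsLpLattice.{u, v} p E) (ρ : G →* LatticeAut E) {E₀ : Set E}
    (hE₀ : Maximal IsDisjointPositive E₀) :
    ∃ (Z : Type u) (_ : MeasurableSpace Z) (μ : Measure Z) (π : G →* NonsingularAut μ)
      (τ : G →* LatticeAut (Lp ℝ p μ)) (Φ : E ≃ₗᵢ[ℝ] Lp ℝ p μ),
      IsConcreteAction π τ ∧ IsGLatticeIso ρ τ Φ ∧
      ∀ e ∈ E₀, ∃ (A : Set Z) (hA : MeasurableSet A) (hμA : μ A ≠ ∞),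
        Φ e = indicatorConstLp p hA hμA (1 : ℝ) := by
  obtain ⟨X, _, μ₀, Φ₀, hΦ₀⟩ := hE
  have hd : Pairwise fun i j : E₀ => LatDisjoint (i : E) (j : E) := fun i j hij =>
    hE₀.prop.2 i.2 j.2 (Subtype.coe_injective.ne hij)
  obtain ⟨ν, J, hν, hJ, hJe⟩ := exists_isDirectSum_latticeIso hp (e := fun i : E₀ => Φ₀ i)
    (fun i => hΦ₀.nonneg_iff.2 (hE₀.prop.1 i i.2).le)
    (fun i j hij => hΦ₀.latDisjoint_iff.2 (hd hij)) (fun w hw => by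
      rw [← map_eq_zero_iff Φ₀.symm Φ₀.symm.injective]
      refine eq_zero_of_maximal_of_latDisjoint hΦ₀ hE₀ fun e he => ?_
      rw [← hΦ₀.latDisjoint_iff, Φ₀.apply_symm_apply]
      exact hw ⟨e, he⟩)
  obtain ⟨μ, Φ, c, hR⟩ := exists_isBandRep hν (hΦ₀.trans hJ) (e := fun i : E₀ => (i : E)) hJe
  obtain ⟨π, τ, h1, h2⟩ := hR.exists_isConcreteAction hp hd ρ
  refine ⟨BandSpace E, inferInstance, μ, π, τ, Φ, h1, h2, fun e he =>
    ⟨c ⟨e, he⟩, hR.measurableSet _, hR.measure_ne_top _, Lp.ext ?_⟩⟩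
  exact (hR.coeFn_unit ⟨e, he⟩).trans indicatorConstLp_coeFn.symm

/-- A subset of the complement with finite measure has its indicator in `L^p`, so it is null;
semi-finiteness excludes infinite measure. -/
theorem measure_compl_eq_zero_of_isWeakUnit {p : ℝ≥0∞} {Z : Type*}
    [MeasurableSpace Z] {μ : Measure Z} (hμ : IsSemifinite μ) {A : Set Z} (hA : MeasurableSet A)
    (h : ∀ w : Lp ℝ p μ, (∀ᵐ z ∂μ, z ∈ A → w z = 0) → w = 0) : μ Aᶜ = 0 := by
  have hfin : ∀ B, MeasurableSet B → B ⊆ Aᶜ → μ B ≠ ∞ → μ B = 0 := fun B hB hBA hBfin => by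
    have h0 := h (indicatorConstLp p hB hBfin 1) (by
      filter_upwards [indicatorConstLp_coeFn (p := p) (hs := hB) (hμs := hBfin) (c := (1 : ℝ))]
        with z hz hzA
      rw [hz, Set.indicator_of_notMem fun hzB => hBA hzB hzA])
    rw [Lp.eq_zero_iff_ae_eq_zero] at h0
    rw [measure_eq_zero_iff_ae_notMem]
    filter_upwards [h0, indicatorConstLp_coeFn (p := p) (hs := hB) (hμs := hBfin) (c := (1 : ℝ))]
      with z h1 h2 hz
    rw [h1, Set.indicator_of_mem hz] at h2
    exact zero_ne_one h2
  by_cases hinf : μ Aᶜ = ∞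
  · obtain ⟨B, hB, hBA, hB0, hBfin⟩ := hμ _ hA.compl hinf
    exact absurd (hfin B hB hBA hBfin.ne) hB0.ne'
  · exact hfin _ hA.compl subset_rfl hinf

section WeakUnit

variable {E : Type*} [NormedAddCommGroup E] [NormedSpace ℝ E] [Lattice E] {p : ℝ≥0∞}
  [Fact (1 ≤ p)]

/-- The set is `{u}`, or empty if `u = 0`; in the latter case `E` is trivial. -/
theorem maximal_isDisjointPositive_of_isWeakUnit {X : Type*} [MeasurableSpace X] {μ : Measure X}
    {T : E ≃ₗᵢ[ℝ] Lp ℝ p μ} (hT : IsLatticeIso T) {u : E} (hu0 : 0 ≤ u) (hu : IsWeakUnit u) :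
    Maximal IsDisjointPositive {x : E | x = u ∧ x ≠ 0} := by
  have hz : ∀ x : E, LatDisjoint 0 x := fun x => by
    rw [← hT.latDisjoint_iff, latDisjoint_iff_ae, map_zero]
    filter_upwards [Lp.coeFn_zero ℝ p μ] with y hy using Or.inl hy
  refine ⟨⟨?_, ?_⟩, fun S hS hsub x hx => ?_⟩
  · rintro x ⟨rfl, hx⟩
    exact lt_of_le_of_ne hu0 hx.symm
  · rintro x ⟨rfl, -⟩ y ⟨rfl, -⟩ hxy
    exact absurd rfl hxy
  · have hx0 : x ≠ 0 := (hS.1 x hx).ne'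
    refine ⟨?_, hx0⟩
    by_contra hxu
    refine hx0 (hu x ?_)
    by_cases h0 : u = 0
    · rw [h0]
      exact hz x
    · exact hS.2 (hsub ⟨rfl, h0⟩) hx (Ne.symm hxu)

end WeakUnit

theorem theorem3p14 {p : ℝ≥0∞} [Fact (1 ≤ p)] (hp : p ≠ ∞)
    {G : Type w} [Group G]
    {E : Type u} [NormedAddCommGroup E] [NormedSpace ℝ E] [Lattice E]
    (hE : IsLpLattice.{u, v} p E) (ρ : G →* LatticeAut E) :
    (∀ E₀ : Set E, Maximal IsDisjointPositive E₀ →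
      ∃ (Z : Type u) (_ : MeasurableSpace Z) (μ : Measure Z) (π : G →* NonsingularAut μ)
        (τ : G →* LatticeAut (Lp ℝ p μ)) (Φ : E ≃ₗᵢ[ℝ] Lp ℝ p μ),
        IsConcreteAction π τ ∧ IsGLatticeIso ρ τ Φ ∧
        ∀ e ∈ E₀, ∃ (A : Set Z) (hA : MeasurableSet A) (hμA : μ A ≠ ∞),
          Φ e = indicatorConstLp p hA hμA (1 : ℝ)) ∧
    (∀ u : E, 0 ≤ u → IsWeakUnit u →
      ∃ (Z : Type u) (_ : MeasurableSpace Z) (μ : Measure Z) (π : G →* NonsingularAut μ)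
        (τ : G →* LatticeAut (Lp ℝ p μ)) (Φ : E ≃ₗᵢ[ℝ] Lp ℝ p μ),
        IsConcreteAction π τ ∧ IsGLatticeIso ρ τ Φ ∧
        μ Set.univ = ENNReal.ofReal (‖u‖ ^ p.toReal) ∧
        ∃ hμ : μ Set.univ ≠ ∞, Φ u = indicatorConstLp p MeasurableSet.univ hμ (1 : ℝ)) := by
  refine ⟨fun E₀ hE₀ => exists_concrete_of_maximal hp hE ρ hE₀, fun u hu0 hu => ?_⟩
  have hp0 := toReal_pos_of_fact hp
  have hmax : Maximal IsDisjointPositive {x : E | x = u ∧ x ≠ 0} := by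
    obtain ⟨X, _, μ₀, Φ₀, hΦ₀⟩ := hE
    exact maximal_isDisjointPositive_of_isWeakUnit hΦ₀ hu0 hu
  obtain ⟨Z, _, μ, π, τ, Φ, hact, hiso, hind⟩ := exists_concrete_of_maximal hp hE ρ hmax
  obtain ⟨A, hA, hAu⟩ : ∃ A : Set Z, MeasurableSet A ∧ Φ u =ᵐ[μ] A.indicator fun _ => 1 := by
    by_cases h0 : u = 0
    · refine ⟨∅, MeasurableSet.empty, ?_⟩
      rw [h0, map_zero, Set.indicator_empty]
      exact Lp.coeFn_zero ℝ p μ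
    · obtain ⟨A, hA, hμA, h⟩ := hind u ⟨rfl, h0⟩
      exact ⟨A, hA, h ▸ indicatorConstLp_coeFn⟩
  -- Whatever vanishes on `A` is disjoint from `Φ u`, hence zero because `u` is a weak unit.
  have hcompl : μ Aᶜ = 0 := measure_compl_eq_zero_of_isWeakUnit (p := p) hact.1 hA fun w hw => by
    rw [← map_eq_zero_iff Φ.symm Φ.symm.injective]
    refine hu _ ?_
    rw [← hiso.1.latDisjoint_iff, Φ.apply_symm_apply, latDisjoint_iff_ae]
    filter_upwards [hw, hAu] with z h1 h2
    by_cases hz : z ∈ A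
    · exact Or.inr (h1 hz)
    · exact Or.inl (by rw [h2, Set.indicator_of_notMem hz])
  have hone : ∀ᵐ z ∂μ, Φ u z = 1 := by
    filter_upwards [hAu, measure_eq_zero_iff_ae_notMem.1 hcompl] with z h1 h2
    rw [h1, Set.indicator_of_mem (not_not.1 h2)]
  have hμu : μ Set.univ = ENNReal.ofReal (‖u‖ ^ p.toReal) := by
    have h1 : ∫⁻ z, ‖Φ u z‖ₑ ^ p.toReal ∂μ = ∫⁻ _, 1 ∂μ := by
      refine lintegral_congr_ae ?_
      filter_upwards [hone] with z hz
      simp [hz]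
    rw [lintegral_one, ← enorm_rpow_toReal hp, LinearIsometryEquiv.enorm_map] at h1
    rw [← h1, ← ENNReal.ofReal_rpow_of_nonneg (norm_nonneg u) hp0.le, ofReal_norm]
  have hfin : μ Set.univ ≠ ∞ := hμu ▸ ENNReal.ofReal_ne_top
  refine ⟨Z, inferInstance, μ, π, τ, Φ, hact, hiso, hμu, hfin, Lp.ext ?_⟩
  filter_upwards [hone, indicatorConstLp_coeFn (p := p) (hs := MeasurableSet.univ) (hμs := hfin)
    (c := (1 : ℝ))] with z h1 h2
  rw [h1, h2, Set.indicator_of_mem (Set.mem_univ z)]
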